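/- For $n\ge 1$ let $S_n$ be the group of permutations of $[n]=\{1,\dots,n\}$, let $F(\sigma)$ be the number of fixed points of $\sigma\in S_n$, and let $|\sigma|=n-F(\sigma)$ be its Hamming distance to the identity. For $n>1$ let $f_n:S_n\to S_{n-1}$ delete the element $n$ from a permutation written in cycle notation. A virtual permutation is a sequence $\boldsymbol\pi=(\pi_1,\pi_2,\dots)$ with $\pi_n\in S_n$ and $f_n(\pi_n)=\pi_{n-1}$ for all $n>1$; the space of virtual permutations carries the $\sigma$-algebra generated by the coordinates. An element $i$ is called singular in $\boldsymbol\pi$ if $\pi_n(i)=i$ for all $n\ge i$, and regular otherwise. A random virtual permutation $\boldsymbol\Pi=(\Pi_1,\Pi_2,\dots)$ is infinitely spherically symmetric (ISS) if for every $n$ the probability $\mathbb P(\Pi_n=\sigma)$ depends on $\sigma\in S_n$ only through $|\sigma|$. The laws of ISS virtual permutations form a convex set; its extreme points are called extreme. The uniform virtual permutation $\boldsymbol\Pi^*$ is built by the Chinese restaurant process: given $\Pi^*_{n-1}$, the element $n$ is inserted in a cycle next to the right of any given element of $[n-1]$ with probability $1/n$, and is appended as a singleton cycle $(n)$ with probability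 $1/n$. For $\alpha\in[0,1]$ define the random virtual permutation $\boldsymbol\Pi^\alpha$ as follows: each element of $\mathbb N$ is marked with probability $\alpha$, independently of the other elements; the marked elements are fixed for ever; and, independently of the marks, the unmarked elements, enumerated in increasing order, form a copy of $\boldsymbol\Pi^*$. Theorem. (1) The extreme ISS virtual permutations are exactly $\{\boldsymbol\Pi^\alpha:\alpha\in[0,1]\}$ (as laws). (2) For every $\alpha\in[0,1]$, almost surely the marked elements are exactly the singular elements of $\boldsymbol\Pi^\alpha$; thus each element is singular with probability $\alpha$, independently of the others, and the regular elements form a uniform virtual permutation. (3) For every $\alpha\in[0,1]$, a random virtual permutation $\boldsymbol\Pi$ has the law of $\boldsymbol\Pi^\alpha$ if and only if for all $n\ge1$ and all $\sigma\in S_n$ with $k$ fixed points $$\mathbb P(\Pi_n=\sigma)=p_{n,k}(\alpha)=\sum_{j=0}^{k}\binom kj\,\alpha^j(1-\alpha)^{n-j}\,\frac1{(n-j)!}.$$ -/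

import Mathlib

open MeasureTheory ProbabilityTheory Finset
open scoped NNReal

/-! The set `[n] = {1, …, n}` is represented by `Fin n`, so that the element called `m` in the
usual numbering is `m - 1` here, and `S_n` is `Equiv.Perm (Fin n)`. -/

/-- Deletion of the largest element from a permutation written in cycle notation. -/
def deleteLast {n : ℕ} (π : Equiv.Perm (Fin (n + 1))) : Equiv.Perm (Fin n) :=
  Equiv.removeNone (finSuccEquivLast.permCongr π)

/-- The predecessor of the largest element in its cycle gets the successor of the largest element
as its new image; all other images are kept. -/
theorem castSucc_deleteLast {n : ℕ} (π : Equiv.Perm (Fin (n + 1))) (i : Fin n) :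
    (deleteLast π i).castSucc =
      if π i.castSucc = Fin.last n then π (Fin.last n) else π i.castSucc := by
  have key : ∀ a : Fin n, ∀ x : Fin (n + 1), some a = finSuccEquivLast x → a.castSucc = x := by
    intro a x h
    rw [← finSuccEquivLast_symm_some, h, Equiv.symm_apply_apply]
  split_ifs with h
  · apply key
    rw [deleteLast, Equiv.removeNone_none]
    · simp [Equiv.permCongr_apply]
    · simp [Equiv.permCongr_apply, h]
  · apply key
    rw [deleteLast, Equiv.removeNone_some]
    · simp [Equiv.permCongr_apply]
    · refine ⟨(π i.castSucc).castPred h, ?_⟩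
      rw [← finSuccEquivLast_castSucc ((π i.castSucc).castPred h), Fin.castSucc_castPred]
      simp [Equiv.permCongr_apply]

/-- Insertion of a new largest element in cycle notation: for `j < n` the new element is put in
the cycle of `j`, next to the right of `j`; for `j = n` it is appended as a singleton cycle. -/
def insertLast {n : ℕ} (σ : Equiv.Perm (Fin n)) (j : Fin (n + 1)) : Equiv.Perm (Fin (n + 1)) :=
  finSuccEquivLast.symm.permCongr σ.optionCongr * Equiv.swap j (Fin.last n)

theorem deleteLast_insertLast {n : ℕ} (σ : Equiv.Perm (Fin n)) (j : Fin (n + 1)) :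
    deleteLast (insertLast σ j) = σ := by
  refine Equiv.ext fun i => Fin.castSucc_injective n ?_
  have hs : ∀ a : Fin n,
      (finSuccEquivLast.symm.permCongr σ.optionCongr) a.castSucc = (σ a).castSucc := by
    intro a; simp [Equiv.permCongr_apply]
  have hl : (finSuccEquivLast.symm.permCongr σ.optionCongr) (Fin.last n) = Fin.last n := by
    simp [Equiv.permCongr_apply]
  have h := castSucc_deleteLast (insertLast σ j) i
  rw [h]
  have hi : i.castSucc ≠ Fin.last n := (Fin.castSucc_lt_last i).ne
  by_cases hj : i.castSucc = j
  · subst hj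
    simp [insertLast, hs, hl]
  · simp [insertLast, Equiv.swap_apply_of_ne_of_ne hj hi, hs, (Fin.castSucc_lt_last _).ne]

/-- A virtual permutation: a sequence of permutations of `[n]`, each obtained from the next one by
deleting the largest element in cycle notation. (The term with `n = 0` is the unique permutation
of the empty set and carries no information.) -/
@[ext]
structure VirtualPerm where
  perm : ∀ n : ℕ, Equiv.Perm (Fin n)
  consistent : ∀ n, deleteLast (perm (n + 1)) = perm n

/-- The sigma-algebra generated by the coordinates, each `S_n` being discrete. -/
instance : MeasurableSpace VirtualPerm :=
  ⨆ n, MeasurableSpace.comap (fun π : VirtualPerm => π.perm n) ⊤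

/-- The Hamming distance of a permutation to the identity permutation. -/
def hammingLength {n : ℕ} (σ : Equiv.Perm (Fin n)) : ℕ :=
  hammingDist (fun i => σ i) (fun i => (1 : Equiv.Perm (Fin n)) i)

/-- The number of fixed points of a permutation. -/
def numFixed {n : ℕ} (σ : Equiv.Perm (Fin n)) : ℕ :=
  #{i | σ i = i}

/-- The distribution `P` of a random virtual permutation is infinitely spherically symmetric: for
each `n` the probability of `σ ∈ S_n` depends on `σ` only through its Hamming distance to the
identity. -/
def IsISS (P : Measure VirtualPerm) : Prop :=
  ∀ (n : ℕ) (σ τ : Equiv.Perm (Fin n)), hammingLength σ = hammingLength τ →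
    P {π | π.perm n = σ} = P {π | π.perm n = τ}

/-- The convex set of distributions of ISS random virtual permutations. -/
def issLaws : Set (Measure VirtualPerm) :=
  {P | IsProbabilityMeasure P ∧ IsISS P}

/-- An element is singular in a virtual permutation if it forms a singleton cycle for ever. -/
def VirtualPerm.IsSingular (π : VirtualPerm) (i : ℕ) : Prop :=
  ∀ (n : ℕ) (h : i < n), π.perm n ⟨i, h⟩ = ⟨i, h⟩

/-- The permutation of `[n]` in the Chinese restaurant process, the new element at step `m + 1`
being inserted at the place `u m`. -/
def crpPerm (u : ∀ m : ℕ, Fin (m + 1)) : ∀ n : ℕ, Equiv.Perm (Fin n)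
  | 0 => 1
  | n + 1 => insertLast (crpPerm u n) (u n)

/-- The virtual permutation built by the Chinese restaurant process. -/
def crp (u : ∀ m : ℕ, Fin (m + 1)) : VirtualPerm where
  perm := crpPerm u
  consistent n := deleteLast_insertLast (crpPerm u n) (u n)

/-- The law of the uniform virtual permutation: in the Chinese restaurant process the places of
insertion are independent, and each is uniform among the available ones. -/
noncomputable def uniformLaw : Measure VirtualPerm :=
  (Measure.infinitePi fun m : ℕ => (PMF.uniformOfFintype (Fin (m + 1))).toMeasure).map crp

/-- The permutation of `Fin n` that acts on `s`, enumerated in increasing order, by `τ`, and fixes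
all elements outside `s`. -/
def placeOn {n k : ℕ} (s : Finset (Fin n)) (h : #s = k) (τ : Equiv.Perm (Fin k)) :
    Equiv.Perm (Fin n) :=
  τ.extendDomain (p := fun x => x ∈ s) (s.orderIsoOfFin h).toEquiv

theorem placeOn_apply {n k : ℕ} (s : Finset (Fin n)) (h : #s = k) (τ : Equiv.Perm (Fin k))
    (i : Fin k) : placeOn s h τ (s.orderEmbOfFin h i) = s.orderEmbOfFin h (τ i) :=
  Equiv.Perm.extendDomain_apply_image τ (p := fun x => x ∈ s) (s.orderIsoOfFin h).toEquiv i

theorem placeOn_apply_of_notMem {n k : ℕ} (s : Finset (Fin n)) (h : #s = k)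
    (τ : Equiv.Perm (Fin k)) {x : Fin n} (hx : x ∉ s) : placeOn s h τ x = x :=
  Equiv.Perm.extendDomain_apply_not_subtype τ (p := fun x => x ∈ s) (s.orderIsoOfFin h).toEquiv hx

open Classical in
/-- The elements of `[n]` that are not in `S`. -/
noncomputable def regularBelow (S : Set ℕ) (n : ℕ) : Finset (Fin n) :=
  {i | (i : ℕ) ∉ S}

theorem mem_regularBelow {S : Set ℕ} {n : ℕ} {i : Fin n} :
    i ∈ regularBelow S n ↔ (i : ℕ) ∉ S := by
  simp [regularBelow]

/-- The permutation of `[n]` that fixes the elements of `S` and acts on the other elements,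
enumerated in increasing order, like the virtual permutation `π`. -/
noncomputable def mergePerm (S : Set ℕ) (π : VirtualPerm) (n : ℕ) : Equiv.Perm (Fin n) :=
  placeOn (regularBelow S n) rfl (π.perm #(regularBelow S n))

theorem mergePerm_eq (S : Set ℕ) (π : VirtualPerm) (n k : ℕ) (h : #(regularBelow S n) = k) :
    mergePerm S π n = placeOn (regularBelow S n) h (π.perm k) := by
  subst h; rfl

theorem mergePerm_consistent (S : Set ℕ) (π : VirtualPerm) (n : ℕ) :
    deleteLast (mergePerm S π (n + 1)) = mergePerm S π n := by
  obtain ⟨k, hk⟩ : ∃ k, #(regularBelow S n) = k := ⟨_, rfl⟩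
  rw [mergePerm_eq S π n k hk]
  set s := regularBelow S n with hs
  set s' := regularBelow S (n + 1) with hs'
  have hmem : ∀ x : Fin n, x.castSucc ∈ s' ↔ x ∈ s := by
    intro x; simp [hs, hs', mem_regularBelow]
  -- it suffices to look at the elements of `s` and at the other ones
  have main : ∀ ρ : Equiv.Perm (Fin (n + 1)), ∀ τ : Equiv.Perm (Fin k),
      (∀ x, x ∉ s → ρ x.castSucc = x.castSucc) →
      (∀ i, (deleteLast ρ (s.orderEmbOfFin hk i)).castSucc
        = (s.orderEmbOfFin hk (τ i)).castSucc) →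
      deleteLast ρ = placeOn s hk τ := by
    intro ρ τ h1 h2
    ext x
    by_cases hx : x ∈ s
    · obtain ⟨i, rfl⟩ : x ∈ Set.range (s.orderEmbOfFin hk) := by simpa using hx
      rw [placeOn_apply, ← Fin.val_castSucc, h2, Fin.val_castSucc]
    · rw [placeOn_apply_of_notMem s hk τ hx, ← Fin.val_castSucc, castSucc_deleteLast, h1 x hx,
        if_neg (Fin.castSucc_lt_last x).ne, Fin.val_castSucc]
  by_cases hl : Fin.last n ∈ s'
  · have hcard : #s' = k + 1 := by
      have : s' = insert (Fin.last n) (s.map Fin.castSuccEmb) := by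
        ext x
        refine Fin.lastCases ?_ (fun y => ?_) x
        · simp [hl]
        · simp [hmem, (Fin.castSucc_lt_last y).ne]
      rw [this, card_insert_of_notMem (by simp [(Fin.castSucc_lt_last _).ne]), card_map, hk]
    have hemb : (Fin.snoc (α := fun _ => Fin (n + 1))
        (fun i => (s.orderEmbOfFin hk i).castSucc) (Fin.last n)) = s'.orderEmbOfFin hcard := by
      apply orderEmbOfFin_unique
      · intro x
        refine Fin.lastCases ?_ (fun y => ?_) x
        · simpa using hl
        · simp [hmem]
      · intro a b
        refine Fin.lastCases ?_ (fun y => ?_) a <;> refine Fin.lastCases ?_ (fun z => ?_) b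
        · simp
        · intro h; exact absurd h (Fin.castSucc_lt_last z).not_gt
        · simp [Fin.castSucc_lt_last]
        · simp
    have hc : ∀ i : Fin k,
        s'.orderEmbOfFin hcard i.castSucc = (s.orderEmbOfFin hk i).castSucc := by
      intro i; rw [← hemb]; simp
    have hlast : s'.orderEmbOfFin hcard (Fin.last k) = Fin.last n := by
      rw [← hemb]; simp
    have hE : mergePerm S π (n + 1) = placeOn s' hcard (π.perm (k + 1)) :=
      mergePerm_eq S π (n + 1) (k + 1) hcard
    rw [hE, ← π.consistent k]
    apply main
    · intro x hx
      exact placeOn_apply_of_notMem _ _ _ (by rwa [hmem])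
    · intro i
      rw [castSucc_deleteLast, ← hc, ← hc, castSucc_deleteLast]
      have e1 := placeOn_apply s' hcard (π.perm (k + 1)) i.castSucc
      have e2 := placeOn_apply s' hcard (π.perm (k + 1)) (Fin.last k)
      rw [hlast] at e2
      rw [e1, e2]
      by_cases hh : π.perm (k + 1) i.castSucc = Fin.last k
      · simp [hh, hlast]
      · rw [if_neg hh, if_neg]
        rw [← hlast]
        exact fun h => hh ((s'.orderEmbOfFin hcard).injective h)
  · have hcard : #s' = k := by
      have : s' = s.map Fin.castSuccEmb := by
        ext x
        refine Fin.lastCases ?_ (fun y => ?_) x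
        · simp [hl, (Fin.castSucc_lt_last _).ne]
        · simp [hmem]
      rw [this, card_map, hk]
    have hemb : (fun i => (s.orderEmbOfFin hk i).castSucc) = s'.orderEmbOfFin hcard := by
      apply orderEmbOfFin_unique
      · intro x; simp [hmem]
      · intro a b hab; simpa using hab
    have hc : ∀ i : Fin k,
        s'.orderEmbOfFin hcard i = (s.orderEmbOfFin hk i).castSucc := by
      intro i; rw [← hemb]
    have hE : mergePerm S π (n + 1) = placeOn s' hcard (π.perm k) :=
      mergePerm_eq S π (n + 1) k hcard
    rw [hE]
    apply main
    · intro x hx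
      exact placeOn_apply_of_notMem _ _ _ (by rwa [hmem])
    · intro i
      have e1 := placeOn_apply s' hcard (π.perm k) i
      rw [castSucc_deleteLast, ← hc, e1, if_neg, hc]
      rw [hc]
      exact (Fin.castSucc_lt_last _).ne

/-- The virtual permutation that fixes the elements of `S` and acts on the other elements of `ℕ`,
enumerated in increasing order, like `π`. -/
noncomputable def merge (S : Set ℕ) (π : VirtualPerm) : VirtualPerm where
  perm := mergePerm S π
  consistent := mergePerm_consistent S π

/-- The law of the data that determine the enriched random virtual permutation with parameter `α`:
a random set to which each element belongs with probability `α`, independently of the other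
elements, and, independently of it, a uniform virtual permutation. -/
noncomputable def enrichedLaw (α : unitInterval) : Measure (Set ℕ × VirtualPerm) :=
  (setBernoulli Set.univ α).prod uniformLaw

/-- The law of `Π^α`: the elements of the random set are fixed for ever, and the other elements,
enumerated in increasing order, form a uniform virtual permutation. -/
noncomputable def piLaw (α : unitInterval) : Measure VirtualPerm :=
  (enrichedLaw α).map fun x => merge x.1 x.2

/-- The probability function
`p_{n,k}(α) = ∑_{j=0}^k (k choose j) α^j (1 - α)^(n-j) / (n-j)!` (used for `k ≤ n`). -/
noncomputable def probFun (α : ℝ) (n k : ℕ) : ℝ :=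
  ∑ j ∈ Finset.range (k + 1),
    (k.choose j : ℝ) * α ^ j * (1 - α) ^ (n - j) / ((n - j).factorial : ℝ)

/-! Under an ISS law, a regular element `i` of `[n]` is almost surely mapped outside `[n]` from some
level on: otherwise its image would be a constant `j ≠ i`, while by symmetry `π_m(i) = j` has
probability at most `1/(m-1)`. So the event that `A` is the singular part of `[n]` is a limit of
events on single permutations: `A` is fixed and the rest of `[n]` is expelled from `[n]`. On these
events, composing on the right with a permutation of `[n] \ A` does not change the fixed points;
conjugation relabels `[n]`. In the limit, the singular set is exchangeable and, given its trace on
`[n]`, the regular elements of `[n]` are permuted uniformly (`IsISS.represents`).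

Hence an ISS law is encoded by the array `c n j` of its singular set, which obeys the Pascal
recursion, and the encoding is injective (`Represents.array_eq`). Conversely, an exchangeable random
set yields an ISS law through `mergeLaw`. Extremality thus becomes a question about exchangeable
random sets, settled without the full theorem of de Finetti. If `Π^α` is a mixture, the array of a
component is at most a multiple of the Bernoulli array, and the weak law of large numbers forces
equality (`IsPascalArray.eq_bernoulliArray_of_le`). Conversely, conditioning on whether the first
element is singular writes a law as a mixture; for an extreme law the condition must be irrelevant,
which makes the array Bernoulli (`singularArray_succ_of_extreme`).

In `Π^α` marked elements are singular; injectivity of the encoding gives both events the same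
probability, so they differ by a null set. The probability function determines the law because the
coordinate events form a π-system. -/

/-! ### Pascal arrays -/

/-- An array of the probabilities `c n j` that an exchangeable random set meets `[n]` in a given
set of `j` elements. -/
structure IsPascalArray (c : ℕ → ℕ → ℝ) : Prop where
  zero : c 0 0 = 1
  nonneg : ∀ {n j}, j ≤ n → 0 ≤ c n j
  pascal : ∀ {n j}, j ≤ n → c n j = c (n + 1) j + c (n + 1) (j + 1)

/-- The probability of a permutation of `[n]` with `k` fixed points if the singular elements have
the array `c` and the regular elements form a uniform permutation. -/
noncomputable def arrayProb (c : ℕ → ℕ → ℝ) (n k : ℕ) : ℝ :=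
  ∑ j ∈ range (k + 1), (k.choose j : ℝ) * c n j / ((n - j).factorial : ℝ)

/-- The total probability over the `i` members of the random set among the next `M` elements. -/
theorem pascal_sum_choose {c : ℕ → ℕ → ℝ}
    (hc : ∀ {n j}, j ≤ n → c n j = c (n + 1) j + c (n + 1) (j + 1)) (M : ℕ) :
    ∀ {n j : ℕ}, j ≤ n →
      c n j = ∑ i ∈ range (M + 1), (M.choose i : ℝ) * c (n + M) (j + i) := by
  induction M with
  | zero => intro n j _; simp
  | succ M ih =>
    intro n j hj
    have e : ∑ i ∈ range (M + 1 + 1), ((M + 1).choose i : ℝ) * c (n + (M + 1)) (j + i) =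
        ∑ i ∈ range (M + 1), (M.choose i : ℝ) * c (n + 1 + M) (j + i) +
        ∑ i ∈ range (M + 1), (M.choose i : ℝ) * c (n + 1 + M) (j + 1 + i) := by
      rw [sum_range_succ', show n + (M + 1) = n + 1 + M by ring]
      have h1 : ∑ i ∈ range (M + 1), (M.choose i : ℝ) * c (n + 1 + M) (j + i) =
          ∑ i ∈ range (M + 1), (M.choose (i + 1) : ℝ) * c (n + 1 + M) (j + (i + 1)) +
            c (n + 1 + M) j := by
        have := sum_range_succ' (fun i => (M.choose i : ℝ) * c (n + 1 + M) (j + i)) (M + 1)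
        rw [sum_range_succ] at this
        simpa using this
      rw [h1]
      simp only [Nat.choose_succ_succ, Nat.cast_add, add_mul, sum_add_distrib]
      simp only [Nat.choose_zero_right, Nat.cast_one, one_mul, add_zero]
      rw [show ∀ a b d : ℝ, a + b + d = (b + d) + a by intros; ring]
      congr 1
      exact sum_congr rfl fun i _ => by rw [add_assoc j 1 i, add_comm 1 i]
    rw [e, ← ih (by omega), ← ih (by omega)]
    exact hc hj

theorem IsPascalArray.le_one {c : ℕ → ℕ → ℝ} (hc : IsPascalArray c) {n j : ℕ} (hj : j ≤ n) :
    c n j ≤ 1 := by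
  have h := pascal_sum_choose hc.pascal n (le_refl 0)
  rw [hc.zero, zero_add] at h
  simp only [zero_add] at h
  rw [h]
  refine le_trans ?_ (single_le_sum (f := fun i => (n.choose i : ℝ) * c n i)
    (fun i hi => ?_) (mem_range.2 (Nat.lt_succ_of_le hj)))
  · exact le_mul_of_one_le_left (hc.nonneg hj) (by exact_mod_cast Nat.choose_pos hj)
  · exact mul_nonneg (by positivity) (hc.nonneg (by simpa [Nat.lt_succ_iff] using hi))

theorem arrayProb_linear (c c' : ℕ → ℕ → ℝ) (a b : ℝ) (n k : ℕ) :
    arrayProb (fun n j => a * c n j + b * c' n j) n k =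
      a * arrayProb c n k + b * arrayProb c' n k := by
  simp only [arrayProb, mul_sum, ← sum_add_distrib]
  exact sum_congr rfl fun j _ => by ring

theorem arrayProb_congr {c c' : ℕ → ℕ → ℝ} {n k : ℕ} (hk : k ≤ n)
    (h : ∀ j ≤ n, c n j = c' n j) : arrayProb c n k = arrayProb c' n k :=
  sum_congr rfl fun j hj => by rw [h j (by have := mem_range.1 hj; omega)]

/-- A bounded solution of the Pascal recursion is determined by the sums `arrayProb c n k` with
`k ≠ n - 1`. -/
theorem eq_zero_of_arrayProb_eq_zero {d : ℕ → ℕ → ℝ} {C : ℝ}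
    (hd : ∀ {n j}, j ≤ n → d n j = d (n + 1) j + d (n + 1) (j + 1))
    (hb : ∀ n, |d n n| ≤ C)
    (h : ∀ n k, k ≤ n → k + 1 ≠ n → arrayProb d n k = 0) {n j : ℕ} (hj : j ≤ n) :
    d n j = 0 := by
  -- For `k ≤ n - 2` the system is triangular in `j`, so only the entries `j = n - 1` and `j = n`
  -- can survive.
  have h1 : ∀ n j, j + 1 < n → d n j = 0 := by
    intro n j
    induction j using Nat.strong_induction_on with
    | _ j ih =>
      intro hjn
      have := h n j (by omega) (by omega)
      rw [arrayProb, sum_range_succ, sum_eq_zero] at this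
      · have hf : ((n - j).factorial : ℝ) ≠ 0 := by positivity
        simpa [hf] using this
      · intro i hi
        rw [ih i (mem_range.1 hi) (by have := mem_range.1 hi; omega)]
        simp
  -- One term of the recursion now vanishes, so the entries with `j = n - 1` are all equal; the
  -- equation `k = n` then expresses the diagonal through them.
  have h2 : ∀ n, d (n + 1) n = d 1 0 := by
    intro n
    induction n with
    | zero => rfl
    | succ n ih =>
      have := hd (Nat.le_succ n)
      rw [h1 (n + 2) n (by omega), zero_add] at this
      rw [← this, ih]
  have h3 : ∀ n, d (n + 1) (n + 1) = -((n + 1 : ℕ) : ℝ) * d 1 0 := by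
    intro n
    have := h (n + 1) (n + 1) le_rfl (by omega)
    rw [arrayProb, sum_range_succ, sum_range_succ, sum_eq_zero, h2] at this
    · simp at this
      push_cast
      linarith
    · intro i hi
      rw [h1 _ _ (by have := mem_range.1 hi; omega)]
      simp
  -- The diagonal grows linearly unless `d 1 0 = 0`; this is the only use of boundedness.
  have h4 : d 1 0 = 0 := by
    by_contra hne
    obtain ⟨N, hN⟩ := exists_nat_gt (C / |d 1 0|)
    have := hb (N + 1)
    rw [h3, abs_mul, abs_neg, Nat.abs_cast] at this
    rw [div_lt_iff₀ (abs_pos.2 hne)] at hN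
    push_cast at this
    nlinarith [abs_pos.2 hne]
  rcases Nat.lt_or_ge (j + 1) n with h5 | h5
  · exact h1 n j h5
  · rcases Nat.lt_or_ge j n with h6 | h6
    · obtain rfl : n = j + 1 := by omega
      rw [h2, h4]
    · obtain rfl : j = n := by omega
      cases j with
      | zero =>
        have := hd (le_refl 0)
        rw [this, h4, h3, h4]; simp
      | succ j => rw [h3, h4, mul_zero]

/-- The values `k = n - 1` must be excluded, since no permutation of `[n]` has exactly `n - 1` fixed
points and a law says nothing about them. -/
theorem IsPascalArray.eq_of_arrayProb {c c' : ℕ → ℕ → ℝ} (hc : IsPascalArray c)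
    (hc' : IsPascalArray c')
    (h : ∀ n k, k ≤ n → k + 1 ≠ n → arrayProb c n k = arrayProb c' n k) {n j : ℕ} (hj : j ≤ n) :
    c n j = c' n j := by
  have := eq_zero_of_arrayProb_eq_zero (d := fun n j => 1 * c n j + (-1) * c' n j) (C := 1)
    (fun {n j} hj => by rw [hc.pascal hj, hc'.pascal hj]; ring)
    (fun n => by
      have h1 := hc.nonneg (le_refl n)
      have h2 := hc.le_one (le_refl n)
      have h3 := hc'.nonneg (le_refl n)
      have h4 := hc'.le_one (le_refl n)
      rw [abs_le]; constructor <;> linarith)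
    (fun n k hk hkn => by rw [arrayProb_linear, h n k hk hkn]; ring) hj
  linarith

/-- The array of the Bernoulli random set. -/
def bernoulliArray (α : ℝ) (n j : ℕ) : ℝ := α ^ j * (1 - α) ^ (n - j)

theorem isPascalArray_bernoulliArray {α : ℝ} (h0 : 0 ≤ α) (h1 : α ≤ 1) :
    IsPascalArray (bernoulliArray α) where
  zero := by simp [bernoulliArray]
  nonneg _ := by have : 0 ≤ 1 - α := by linarith
                 unfold bernoulliArray; positivity
  pascal {n j} hj := by
    simp only [bernoulliArray]
    rw [show n + 1 - j = (n - j) + 1 by omega, show n + 1 - (j + 1) = n - j by omega]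
    ring

theorem arrayProb_bernoulliArray (α : ℝ) (n k : ℕ) :
    arrayProb (bernoulliArray α) n k = probFun α n k := by
  simp [arrayProb, probFun, bernoulliArray, mul_assoc]

/-- The product rule gives the next row for positive `j`, and the Pascal recursion its entry at `0`.
-/
theorem IsPascalArray.eq_bernoulliArray {c : ℕ → ℕ → ℝ} (hc : IsPascalArray c) {α : ℝ}
    (h : ∀ n j, j ≤ n → c (n + 1) (j + 1) = α * c n j) {n j : ℕ} (hj : j ≤ n) :
    c n j = bernoulliArray α n j := by
  induction n generalizing j with
  | zero => obtain rfl : j = 0 := by omega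
            simp [hc.zero, bernoulliArray]
  | succ n ih =>
    cases j with
    | zero =>
      have h1 := hc.pascal (Nat.zero_le n)
      rw [h n 0 (Nat.zero_le n), ih (Nat.zero_le n)] at h1
      simp only [bernoulliArray, pow_zero, Nat.sub_zero, one_mul] at h1 ⊢
      rw [pow_succ]; linarith
    | succ j =>
      rw [h n j (by omega), ih (by omega)]
      simp only [bernoulliArray]
      rw [show n + 1 - (j + 1) = n - j by omega]; ring

/-- The variance `α(1 - α)/M` of a binomial frequency, known from Bernstein polynomials. -/
theorem sum_bernoulliArray_sq (α : unitInterval) {M : ℕ} (hM : M ≠ 0) :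
    ∑ i ∈ range (M + 1), (M.choose i : ℝ) * bernoulliArray α M i * ((i : ℝ) / M - α) ^ 2
      ≤ 1 / M := by
  have h := bernstein.variance hM α
  rw [← Fin.sum_univ_eq_sum_range (fun i : ℕ => (M.choose i : ℝ) * bernoulliArray α M i *
    ((i : ℝ) / M - α) ^ 2)]
  calc _ = ∑ k : Fin (M + 1), ((α : ℝ) - (bernstein.z k : unitInterval)) ^ 2 * bernstein M k α := by
        refine sum_congr rfl fun k _ => ?_
        simp only [bernstein_apply, bernstein.z, bernoulliArray]
        ring
    _ = (α : ℝ) * (1 - α) / M := h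
    _ ≤ 1 / M := by
        have h0 := α.2.1
        have h1 := α.2.2
        gcongr
        nlinarith

/-- A Pascal array dominated by a multiple of the Bernoulli array is the Bernoulli array. -/
theorem IsPascalArray.eq_bernoulliArray_of_le {c : ℕ → ℕ → ℝ} (hc : IsPascalArray c)
    (α : unitInterval) {K : ℝ} (hle : ∀ n j, j ≤ n → c n j ≤ K * bernoulliArray α n j)
    {n j : ℕ} (hj : j ≤ n) : c n j = bernoulliArray α n j := by
  have hK : 0 ≤ K := by
    have := hle 0 0 le_rfl
    simp [hc.zero, bernoulliArray] at this; linarith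
  have hα0 : (0 : ℝ) ≤ α := α.2.1
  have hα1 : 0 ≤ 1 - (α : ℝ) := by linarith [α.2.2]
  have hα1' : 1 - (α : ℝ) ≤ 1 := by linarith
  refine hc.eq_bernoulliArray (fun n j hj => ?_) hj
  -- the difference of the two sides is a mean of `i / M - α`
  have key : ∀ M : ℕ, M ≠ 0 → c (n + 1) (j + 1) - α * c n j =
      ∑ i ∈ range (M + 1), (M.choose i : ℝ) * c (n + M) (j + i) * ((i : ℝ) / M - α) := by
    intro M hM
    obtain ⟨m, rfl⟩ := Nat.exists_eq_succ_of_ne_zero hM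
    rw [pascal_sum_choose hc.pascal (m + 1) hj,
      pascal_sum_choose hc.pascal m (show j + 1 ≤ n + 1 by omega)]
    simp only [mul_sub, sum_sub_distrib, mul_sum]
    congr 1
    · rw [sum_range_succ' _ (m + 1)]
      simp only [CharP.cast_eq_zero, zero_div, mul_zero, add_zero]
      refine sum_congr rfl fun i _ => ?_
      -- Both entries are expanded to level `n + M`; the weight `(i/M) * M.choose i` is
      -- `(M-1).choose (i-1)`.
      have h := Nat.add_one_mul_choose_eq m i
      have h' : ((m : ℝ) + 1) * m.choose i = ((m + 1).choose (i + 1) : ℝ) * (i + 1) := by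
        exact_mod_cast h
      rw [show n + 1 + m = n + (m + 1) by ring, show j + 1 + i = j + (i + 1) by ring]
      push_cast
      field_simp
      linear_combination c (n + (m + 1)) (j + (i + 1)) * h'
    · exact sum_congr rfl fun i _ => by ring
  have bound : ∀ ε : ℝ, 0 < ε → ∀ M : ℕ, M ≠ 0 →
      |c (n + 1) (j + 1) - α * c n j| ≤ ε + K * (1 / M) / ε := by
    intro ε hε M hM
    rw [key M hM]
    have hpt : ∀ i ∈ range (M + 1),
        |(M.choose i : ℝ) * c (n + M) (j + i) * ((i : ℝ) / M - α)| ≤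
        ε * ((M.choose i : ℝ) * c (n + M) (j + i)) +
        K / ε * ((M.choose i : ℝ) * bernoulliArray α M i * ((i : ℝ) / M - α) ^ 2) := by
      intro i hi
      have hi' : i ≤ M := by have := mem_range.1 hi; omega
      have hc0 : 0 ≤ c (n + M) (j + i) := hc.nonneg (by omega)
      -- The factors `α ^ j` and `(1 - α) ^ (n - j)` are at most `1` and are dropped.
      have hcK : c (n + M) (j + i) ≤ K * bernoulliArray α M i := by
        refine (hle _ _ (by omega)).trans (mul_le_mul_of_nonneg_left ?_ hK)
        simp only [bernoulliArray]
        gcongr ?_ * ?_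
        · exact pow_le_pow_of_le_one hα0 α.2.2 (by omega)
        · exact pow_le_pow_of_le_one hα1 hα1' (by omega)
      set x := (i : ℝ) / M - α
      rw [abs_mul, abs_of_nonneg (by positivity)]
      -- Chebyshev's splitting: the term `ε` is summed against `c`, with total `c n j ≤ 1`, and the
      -- square against the Bernoulli array, with total at most `1 / M`.
      have hx : |x| ≤ ε + x ^ 2 / ε := by
        rw [← sq_abs x, ← sub_nonneg]
        have : ε + |x| ^ 2 / ε - |x| = ((|x| - ε / 2) ^ 2 + 3 / 4 * ε ^ 2) / ε := by
          field_simp; ring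
        rw [this]; positivity
      calc (M.choose i : ℝ) * c (n + M) (j + i) * |x|
          ≤ (M.choose i : ℝ) * c (n + M) (j + i) * (ε + x ^ 2 / ε) := by gcongr
        _ = ε * ((M.choose i : ℝ) * c (n + M) (j + i)) +
            (M.choose i : ℝ) * c (n + M) (j + i) * (x ^ 2 / ε) := by ring
        _ ≤ ε * ((M.choose i : ℝ) * c (n + M) (j + i)) +
            (M.choose i : ℝ) * (K * bernoulliArray α M i) * (x ^ 2 / ε) := by gcongr
        _ = _ := by ring
    refine (abs_sum_le_sum_abs _ _).trans ((sum_le_sum hpt).trans ?_)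
    rw [sum_add_distrib, ← mul_sum, ← mul_sum, ← pascal_sum_choose hc.pascal M hj]
    have h1 := hc.le_one hj
    have h2 := sum_bernoulliArray_sq α hM
    have h3 : K / ε * (∑ i ∈ range (M + 1), (M.choose i : ℝ) * bernoulliArray α M i *
        ((i : ℝ) / M - α) ^ 2) ≤ K / ε * (1 / M) := by gcongr
    have h4 : K * (1 / (M : ℝ)) / ε = K / ε * (1 / M) := by ring
    nlinarith
  have : |c (n + 1) (j + 1) - α * c n j| ≤ 0 := by
    refine le_of_forall_pos_le_add fun ε hε => ?_
    rw [zero_add]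
    have lim : Filter.Tendsto (fun M : ℕ => ε + K * (1 / (M : ℝ)) / ε) Filter.atTop
        (nhds (ε + K * 0 / ε)) :=
      ((tendsto_one_div_atTop_nhds_zero_nat.const_mul K).div_const ε).const_add ε
    have := ge_of_tendsto lim ((Filter.eventually_ne_atTop 0).mono fun M hM => bound ε hε M hM)
    simpa using this
  linarith [abs_nonpos_iff.1 this]

/-! ### Permutations -/

theorem numFixed_add_hammingLength {n : ℕ} (σ : Equiv.Perm (Fin n)) :
    numFixed σ + hammingLength σ = n := by
  have := card_filter_add_card_filter_not (s := (univ : Finset (Fin n))) (fun i => σ i = i)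
  rw [card_univ, Fintype.card_fin] at this
  rw [numFixed, hammingLength, hammingDist]
  convert this using 3
  ext x
  rw [mem_filter, mem_filter]
  simp

theorem numFixed_le {n : ℕ} (σ : Equiv.Perm (Fin n)) : numFixed σ ≤ n := by
  have := numFixed_add_hammingLength σ
  omega

theorem hammingLength_eq_of_fixed_iff {n : ℕ} {σ τ : Equiv.Perm (Fin n)}
    (h : ∀ x, σ x = x ↔ τ x = x) : hammingLength σ = hammingLength τ := by
  unfold hammingLength hammingDist
  congr 1
  ext x
  rw [mem_filter, mem_filter]
  simp [h]

theorem hammingLength_conj {n : ℕ} (g σ : Equiv.Perm (Fin n)) :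
    hammingLength (g * σ * g⁻¹) = hammingLength σ := by
  have : numFixed (g * σ * g⁻¹) = numFixed σ := by
    unfold numFixed
    refine (card_equiv g fun x => ?_).symm
    rw [mem_filter, mem_filter]
    simp
  have h1 := numFixed_add_hammingLength σ
  have h2 := numFixed_add_hammingLength (g * σ * g⁻¹)
  omega

theorem exists_numFixed_eq {n k : ℕ} (hk : k ≤ n) (hkn : k + 1 ≠ n) :
    ∃ σ : Equiv.Perm (Fin n), numFixed σ = k := by
  rcases Nat.eq_or_lt_of_le hk with rfl | hlt
  · exact ⟨1, by simp [numFixed]⟩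
  · obtain ⟨m, rfl⟩ : ∃ m, n = m + 1 := ⟨n - 1, by omega⟩
    -- The cycle on `0, …, m - k` moves all its `n - k ≥ 2` points and leaves `k` fixed.
    let i : Fin (m + 1) := ⟨m - k, by omega⟩
    refine ⟨Fin.cycleRange i, ?_⟩
    have : ∀ j : Fin (m + 1), Fin.cycleRange i j = j ↔ i < j := by
      intro j
      rcases lt_trichotomy j i with h | h | h
      · have h1 := Fin.cycleRange_of_lt h
        refine ⟨fun e => ?_, fun e => absurd e h.not_gt⟩
        rw [e] at h1
        have h2 : (j : ℕ) + 1 < m + 1 := by have := i.2; have : (j : ℕ) < i := h; omega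
        have h3 := congrArg Fin.val h1
        rw [Fin.val_add_one_of_lt' h2] at h3
        omega
      · rw [h]
        have h1 : Fin.cycleRange i i = 0 := Fin.cycleRange_self i
        refine ⟨fun e => ?_, fun e => absurd e (lt_irrefl _)⟩
        rw [h1] at e
        have h3 : (0 : ℕ) = m - k := by simpa [i] using congrArg Fin.val e
        omega
      · exact ⟨fun _ => h, fun _ => Fin.cycleRange_of_gt h⟩
    simp only [numFixed, this]
    have h : ({x | i < x} : Finset (Fin (m + 1))) = Ioi i := by ext x; simp
    rw [h, Fin.card_Ioi]
    simp [i]; omega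

theorem insertLast_last_castSucc {n : ℕ} (σ : Equiv.Perm (Fin n)) (i : Fin n) :
    insertLast σ (Fin.last n) i.castSucc = (σ i).castSucc := by
  simp [insertLast, Equiv.permCongr_apply]

theorem insertLast_last_last {n : ℕ} (σ : Equiv.Perm (Fin n)) :
    insertLast σ (Fin.last n) (Fin.last n) = Fin.last n := by
  simp [insertLast, Equiv.permCongr_apply]

theorem insertLast_eq {n : ℕ} (σ : Equiv.Perm (Fin n)) (j : Fin (n + 1)) :
    insertLast σ j = insertLast σ (Fin.last n) * Equiv.swap j (Fin.last n) := by
  rw [insertLast, insertLast, Equiv.swap_self]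
  rfl

theorem insertLast_symm_last {n : ℕ} (σ : Equiv.Perm (Fin n)) (j : Fin (n + 1)) :
    (insertLast σ j).symm (Fin.last n) = j := by
  rw [Equiv.symm_apply_eq, insertLast_eq]
  simp [insertLast_last_last]

/-- The place of insertion is the preimage of the largest element. With `deleteLast_insertLast` and
`insertLast_symm_last`, insertion is a bijection from `S_n × [n + 1]` to `S_{n+1}`. -/
theorem insertLast_deleteLast {n : ℕ} (σ : Equiv.Perm (Fin (n + 1))) :
    insertLast (deleteLast σ) (σ.symm (Fin.last n)) = σ := by
  rw [insertLast_eq]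
  set j := σ.symm (Fin.last n) with hj
  have hσj : σ j = Fin.last n := by simp [hj]
  have key : ∀ i : Fin n, i.castSucc ≠ j → (deleteLast σ i).castSucc = σ i.castSucc := by
    intro i hi
    rw [castSucc_deleteLast, if_neg]
    rw [← hσj]; exact fun h => hi (σ.injective h)
  refine Equiv.ext fun x => ?_
  rw [Equiv.Perm.mul_apply]
  by_cases hx : x = j
  · rw [hx, Equiv.swap_apply_left, insertLast_last_last, hσj]
  · by_cases hl : x = Fin.last n
    · subst hl
      rw [Equiv.swap_apply_right]
      obtain ⟨i, hi⟩ := Fin.exists_castSucc_eq.2 (Ne.symm hx)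
      rw [← hi, insertLast_last_castSucc, castSucc_deleteLast, if_pos]
      rw [hi, hσj]
    · rw [Equiv.swap_apply_of_ne_of_ne hx hl]
      obtain ⟨i, rfl⟩ := Fin.exists_castSucc_eq.2 hl
      rw [insertLast_last_castSucc, key i hx]

/-- A permutation fixing everything outside `s` preserves `s`, so it comes from its restriction. In
this form an event on a merged permutation becomes a single coordinate event. -/
theorem placeOn_eq_iff_exists {n k : ℕ} (s : Finset (Fin n)) (h : #s = k)
    (σ : Equiv.Perm (Fin n)) (hσ : ∀ x, x ∉ s → σ x = x) :
    ∃ ρ : Equiv.Perm (Fin k), ∀ τ, placeOn s h τ = σ ↔ τ = ρ := by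
  have hinj : Function.Injective (placeOn s h) :=
    Equiv.Perm.extendDomainHom_injective (p := fun x => x ∈ s) (s.orderIsoOfFin h).toEquiv
  have hmem : ∀ x, σ x ∈ s ↔ x ∈ s := by
    intro x
    constructor
    · intro hx
      by_contra hx'
      rw [hσ x hx'] at hx
      exact hx' hx
    · intro hx
      by_contra hx'
      have := σ.injective (hσ _ hx')
      rw [this] at hx'
      exact hx' hx
  let e := (s.orderIsoOfFin h).toEquiv
  obtain ⟨ρ, hρ⟩ : ∃ ρ, placeOn s h ρ = σ := by
    refine ⟨e.symm.permCongr (σ.subtypePerm hmem), Equiv.ext fun x => ?_⟩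
    by_cases hx : x ∈ s
    · rw [placeOn, Equiv.Perm.extendDomain_apply_subtype _ (p := fun x => x ∈ s) _ hx]
      simp [Equiv.permCongr_apply, e]
    · rw [placeOn_apply_of_notMem s h _ hx, hσ x hx]
  exact ⟨ρ, fun τ => by rw [← hρ]; exact hinj.eq_iff⟩

/-! ### Laws of virtual permutations -/

theorem measurable_perm (n : ℕ) : Measurable[_, ⊤] fun π : VirtualPerm => π.perm n :=
  Measurable.of_comap_le (le_iSup (fun n =>
    MeasurableSpace.comap (fun π : VirtualPerm => π.perm n) ⊤) n)

theorem measurableSet_perm {n : ℕ} (p : Equiv.Perm (Fin n) → Prop) :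
    MeasurableSet {π : VirtualPerm | p (π.perm n)} :=
  measurable_perm n (t := {σ | p σ}) trivial

theorem VirtualPerm.perm_eq_of_le {n m : ℕ} (h : n ≤ m) {π π' : VirtualPerm}
    (e : π.perm m = π'.perm m) : π.perm n = π'.perm n := by
  induction h with
  | refl => exact e
  | step _ ih => exact ih (by rw [← π.consistent, ← π'.consistent, e])

theorem generateFrom_perm : (inferInstance : MeasurableSpace VirtualPerm) =
    MeasurableSpace.generateFrom
      {s | ∃ (n : ℕ) (σ : Equiv.Perm (Fin n)), {π : VirtualPerm | π.perm n = σ} = s} := by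
  apply le_antisymm
  · refine iSup_le fun n => ?_
    rintro _ ⟨t, -, rfl⟩
    have : (fun π : VirtualPerm => π.perm n) ⁻¹' t = ⋃ σ ∈ t, {π | π.perm n = σ} := by
      ext π; simp
    rw [this]
    exact MeasurableSet.biUnion t.to_countable fun σ _ =>
      MeasurableSpace.measurableSet_generateFrom ⟨n, σ, rfl⟩
  · refine MeasurableSpace.generateFrom_le ?_
    rintro _ ⟨n, σ, rfl⟩
    exact measurableSet_perm (fun τ => τ = σ)

/-- The permutation at a level determines those at lower levels, so two coordinate events are nested
or disjoint. -/
theorem isPiSystem_perm : IsPiSystem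
    {s | ∃ (n : ℕ) (σ : Equiv.Perm (Fin n)), {π : VirtualPerm | π.perm n = σ} = s} := by
  have key : ∀ n m : ℕ, n ≤ m → ∀ (σ : Equiv.Perm (Fin n)) (τ : Equiv.Perm (Fin m)),
      ({π : VirtualPerm | π.perm n = σ} ∩ {π | π.perm m = τ}).Nonempty →
      {π : VirtualPerm | π.perm n = σ} ∩ {π | π.perm m = τ} = {π | π.perm m = τ} := by
    rintro n m h σ τ ⟨π, rfl, rfl⟩
    refine Set.inter_eq_right.2 fun π' hπ' => VirtualPerm.perm_eq_of_le h hπ'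
  rintro _ ⟨n, σ, rfl⟩ _ ⟨m, τ, rfl⟩ hne
  rcases le_total n m with h | h
  · exact ⟨m, τ, (key n m h σ τ hne).symm⟩
  · rw [Set.inter_comm] at hne ⊢
    exact ⟨n, σ, (key m n h τ σ hne).symm⟩

theorem ext_of_perm {P Q : Measure VirtualPerm} [IsProbabilityMeasure P] [IsProbabilityMeasure Q]
    (h : ∀ (n : ℕ) (σ : Equiv.Perm (Fin n)),
      P.real {π | π.perm n = σ} = Q.real {π | π.perm n = σ}) : P = Q := by
  refine ext_of_generate_finite _ generateFrom_perm isPiSystem_perm ?_ (by simp)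
  rintro _ ⟨n, σ, rfl⟩
  have := h n σ
  rwa [measureReal_def, measureReal_def,
    ENNReal.toReal_eq_toReal_iff' (measure_ne_top _ _) (measure_ne_top _ _)] at this

theorem measurable_of_perm {Ω : Type*} [MeasurableSpace Ω] {f : Ω → VirtualPerm}
    (h : ∀ (n : ℕ) (σ : Equiv.Perm (Fin n)), MeasurableSet {x | (f x).perm n = σ}) :
    Measurable f := by
  have := measurable_generateFrom (f := f) (s :=
    {s | ∃ (n : ℕ) (σ : Equiv.Perm (Fin n)), {π : VirtualPerm | π.perm n = σ} = s})
    (by rintro _ ⟨n, σ, rfl⟩; exact h n σ)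
  rwa [← generateFrom_perm] at this

/-- The law `P` has the probability function of a random virtual permutation with uniform regular
part and singular set with array `c`. -/
def Represents (P : Measure VirtualPerm) (c : ℕ → ℕ → ℝ) : Prop :=
  ∀ (n : ℕ) (σ : Equiv.Perm (Fin n)), P.real {π | π.perm n = σ} = arrayProb c n (numFixed σ)

theorem Represents.isISS {P : Measure VirtualPerm} [IsProbabilityMeasure P] {c : ℕ → ℕ → ℝ}
    (h : Represents P c) : IsISS P := by
  intro n σ τ hστ
  have e : numFixed σ = numFixed τ := by
    have h1 := numFixed_add_hammingLength σ
    have h2 := numFixed_add_hammingLength τ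
    omega
  have := (h n σ).trans ((congrArg _ e).trans (h n τ).symm)
  rwa [measureReal_def, measureReal_def,
    ENNReal.toReal_eq_toReal_iff' (measure_ne_top _ _) (measure_ne_top _ _)] at this

theorem Represents.eq_of_array {P Q : Measure VirtualPerm} [IsProbabilityMeasure P]
    [IsProbabilityMeasure Q] {c c' : ℕ → ℕ → ℝ} (hP : Represents P c) (hQ : Represents Q c')
    (h : ∀ n j, j ≤ n → c n j = c' n j) : P = Q :=
  ext_of_perm fun n σ => by
    rw [hP, hQ, arrayProb_congr (numFixed_le σ) (h n)]

theorem Represents.array_eq {P : Measure VirtualPerm} {c c' : ℕ → ℕ → ℝ} (hP : Represents P c)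
    (hP' : Represents P c') (hc : IsPascalArray c) (hc' : IsPascalArray c') {n j : ℕ}
    (hj : j ≤ n) : c n j = c' n j := by
  refine hc.eq_of_arrayProb hc' (fun n k hk hkn => ?_) hj
  obtain ⟨σ, rfl⟩ := exists_numFixed_eq hk hkn
  rw [← hP, ← hP']

/-! ### The uniform virtual permutation -/

/-- Each `σ` has exactly one history of insertions. Its event is thus a box for the product measure,
of probability `∏ 1/(i+1) = 1/n!`. -/
theorem exists_crpPerm_eq_iff (n : ℕ) (σ : Equiv.Perm (Fin n)) :
    ∃ v : ∀ m : ℕ, Fin (m + 1), ∀ u, crpPerm u n = σ ↔ ∀ i < n, u i = v i := by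
  induction n with
  | zero => exact ⟨fun _ => 0, fun u => by simp [Subsingleton.elim (crpPerm u 0) σ]⟩
  | succ n ih =>
    obtain ⟨v, hv⟩ := ih (deleteLast σ)
    refine ⟨Function.update v n (σ.symm (Fin.last n)), fun u => ?_⟩
    have h1 : crpPerm u (n + 1) = σ ↔
        crpPerm u n = deleteLast σ ∧ u n = σ.symm (Fin.last n) := by
      change insertLast (crpPerm u n) (u n) = σ ↔ _
      constructor
      · rintro rfl
        rw [deleteLast_insertLast, insertLast_symm_last]
        exact ⟨rfl, rfl⟩
      · rintro ⟨h1, h2⟩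
        rw [h1, h2, insertLast_deleteLast]
    rw [h1, hv]
    constructor
    · rintro ⟨h2, h3⟩ i hi
      rcases Nat.lt_succ_iff_lt_or_eq.1 hi with h | rfl
      · rw [Function.update_of_ne h.ne, h2 i h]
      · simpa using h3
    · intro h
      refine ⟨fun i hi => ?_, by simpa using h n (Nat.lt_succ_self n)⟩
      rw [h i (by omega), Function.update_of_ne hi.ne]

theorem crp_preimage {n : ℕ} {σ : Equiv.Perm (Fin n)} {v : ∀ m : ℕ, Fin (m + 1)}
    (hv : ∀ u, crpPerm u n = σ ↔ ∀ i < n, u i = v i) :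
    crp ⁻¹' {π | π.perm n = σ} = Set.pi (range n : Finset ℕ) fun i => {v i} := by
  ext u
  have : (crp u).perm n = σ ↔ ∀ i < n, u i = v i := hv u
  simp [Set.mem_pi, this]

theorem measurable_crp : Measurable crp := by
  refine measurable_of_perm fun n σ => ?_
  obtain ⟨v, hv⟩ := exists_crpPerm_eq_iff n σ
  have := crp_preimage hv
  rw [Set.preimage_ofPred_eq] at this
  rw [this]
  exact MeasurableSet.pi (Finset.countable_toSet _) fun _ _ => measurableSet_singleton _

instance : IsProbabilityMeasure uniformLaw :=
  Measure.isProbabilityMeasure_map measurable_crp.aemeasurable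

theorem uniformLaw_perm (n : ℕ) (σ : Equiv.Perm (Fin n)) :
    uniformLaw.real {π | π.perm n = σ} = 1 / (n.factorial : ℝ) := by
  obtain ⟨v, hv⟩ := exists_crpPerm_eq_iff n σ
  rw [measureReal_def, uniformLaw, Measure.map_apply measurable_crp
    (measurableSet_perm fun τ => τ = σ), crp_preimage hv,
    Measure.infinitePi_pi _ fun _ _ => measurableSet_singleton _, ENNReal.toReal_prod]
  simp only [PMF.toMeasure_apply_singleton _ _ (measurableSet_singleton _),
    PMF.uniformOfFintype_apply, Fintype.card_fin]
  rw [← prod_range_add_one_eq_factorial, Nat.cast_prod, one_div, ← prod_inv_distrib]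
  exact prod_congr rfl fun i _ => by rw [ENNReal.toReal_inv, ENNReal.toReal_natCast]

/-! ### Exchangeable random sets -/

/-- The sets `X ⊆ ℕ` that meet `[n]` in `A`. -/
def setCylinder (n : ℕ) (A : Finset (Fin n)) : Set (Set ℕ) :=
  {X | ∀ i : Fin n, (i : ℕ) ∈ X ↔ i ∈ A}

theorem measurableSet_setCylinder (n : ℕ) (A : Finset (Fin n)) :
    MeasurableSet (setCylinder n A) := by
  have : setCylinder n A = ⋂ i : Fin n, {X : Set ℕ | (i : ℕ) ∈ X ↔ i ∈ A} := by
    ext X; simp [setCylinder]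
  rw [this]
  refine MeasurableSet.iInter fun i => ?_
  by_cases hi : i ∈ A
  · simpa [hi] using measurableSet_mem (i : ℕ)
  · simpa [hi] using measurableSet_notMem (i : ℕ)

theorem disjoint_setCylinder {n : ℕ} {A B : Finset (Fin n)} (h : A ≠ B) :
    Disjoint (setCylinder n A) (setCylinder n B) :=
  Set.disjoint_left.2 fun _ hA hB => h (Finset.ext fun i => (hA i).symm.trans (hB i))

theorem exists_mem_setCylinder (n : ℕ) (X : Set ℕ) : ∃ A, X ∈ setCylinder n A := by
  classical
  exact ⟨univ.filter fun i => (i : ℕ) ∈ X, fun i => by simp⟩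

theorem regularBelow_eq_of_mem {n : ℕ} {A : Finset (Fin n)} {X : Set ℕ}
    (h : X ∈ setCylinder n A) : regularBelow X n = Aᶜ := by
  ext i
  rw [mem_regularBelow, mem_compl, h i]

/-- The random set with law `ν` is exchangeable with array `c`. -/
def HasArray (ν : Measure (Set ℕ)) (c : ℕ → ℕ → ℝ) : Prop :=
  ∀ (n : ℕ) (A : Finset (Fin n)), ν.real (setCylinder n A) = c n #A

theorem setCylinder_eq_union (n : ℕ) (A : Finset (Fin n)) :
    setCylinder n A = setCylinder (n + 1) (A.map Fin.castSuccEmb) ∪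
      setCylinder (n + 1) (insert (Fin.last n) (A.map Fin.castSuccEmb)) := by
  ext X
  simp only [setCylinder, Set.mem_union, Set.mem_ofPred_eq, Fin.forall_fin_succ']
  by_cases h : n ∈ X <;> simp [h, (Fin.castSucc_lt_last _).ne]

theorem HasArray.isPascalArray {ν : Measure (Set ℕ)} [IsProbabilityMeasure ν] {c : ℕ → ℕ → ℝ}
    (h : HasArray ν c) : IsPascalArray c where
  zero := by
    have e : setCylinder 0 ∅ = Set.univ := by ext X; simp [setCylinder]
    have := h 0 ∅
    rw [e] at this
    simpa using this.symm
  nonneg {n j} hj := by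
    obtain ⟨A, -, rfl⟩ := exists_subset_card_eq (s := (univ : Finset (Fin n))) (n := j) (by simpa)
    rw [← h]; exact measureReal_nonneg
  pascal {n j} hj := by
    obtain ⟨A, -, rfl⟩ := exists_subset_card_eq (s := (univ : Finset (Fin n))) (n := j) (by simpa)
    have hl : Fin.last n ∉ A.map Fin.castSuccEmb := by simp [(Fin.castSucc_lt_last _).ne]
    rw [← h, setCylinder_eq_union, measureReal_union, h, h, card_map, card_insert_of_notMem hl,
      card_map]
    · refine disjoint_setCylinder fun e => hl ?_
      rw [e]; exact mem_insert_self _ _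
    · exact measurableSet_setCylinder _ _

theorem hasArray_setBernoulli (α : unitInterval) :
    HasArray (setBernoulli Set.univ α) (bernoulliArray α) := by
  classical
  intro n A
  -- The product measure is indexed by `ℕ`, so the sides of the box need a subset of `ℕ`.
  let B : Finset ℕ := A.map Fin.valEmbedding
  have hB : ∀ i : Fin n, (i : ℕ) ∈ B ↔ i ∈ A := by
    intro i; simp [B, Fin.val_inj]
  have e : (fun p : ℕ → Prop => {i | p i}) ⁻¹' setCylinder n A =
      Set.pi (range n : Finset ℕ) fun i => {p : Prop | p ↔ i ∈ B} := by
    ext p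
    simp only [setCylinder, Set.mem_preimage, Set.mem_ofPred_eq, Set.mem_pi, coe_range, Set.mem_Iio,
      Fin.forall_iff]
    exact forall_congr' fun i => forall_congr' fun hi => by
      rw [← hB ⟨i, hi⟩]
  rw [measureReal_def, setBernoulli_apply', e, Measure.infinitePi_pi _ fun _ _ => MeasurableSet.of_discrete,
    ENNReal.toReal_prod, prod_range]
  have h1 : ∀ i : Fin n, ((unitInterval.toNNReal α • Measure.dirac ((i : ℕ) ∈ Set.univ) +
      unitInterval.toNNReal (unitInterval.symm α) • Measure.dirac False : Measure Prop)
      {p : Prop | p ↔ (i : ℕ) ∈ B}).toReal = if i ∈ A then (α : ℝ) else 1 - α := by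
    intro i
    by_cases hi : i ∈ A <;> simp [hB, hi]
  rw [prod_congr rfl fun i _ => h1 i, prod_ite, prod_const, prod_const, bernoulliArray]
  congr 2
  · simp
  · rw [filter_not]; simp [card_sdiff]

/-! ### Fixing a random set and permuting the other elements uniformly -/

/-- The law of the virtual permutation with marked set of law `ν` and uniform unmarked part. -/
noncomputable def mergeLaw (ν : Measure (Set ℕ)) : Measure VirtualPerm :=
  (ν.prod uniformLaw).map fun x => merge x.1 x.2

/-- Once the marks in `[n]` are known to be `A`, the merged permutation depends on `π` only through
its level `n - #A`. The event of being `σ` is therefore a finite union of rectangles, which yields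
both measurability and probability. -/
theorem exists_merge_slice {n : ℕ} (σ : Equiv.Perm (Fin n)) (A : Finset (Fin n)) :
    ∃ T : Set VirtualPerm, MeasurableSet T ∧
      (∀ X ∈ setCylinder n A, ∀ π, (merge X π).perm n = σ ↔ π ∈ T) ∧
      uniformLaw.real T =
        if A ⊆ ({i | σ i = i} : Finset (Fin n)) then 1 / ((n - #A).factorial : ℝ) else 0 := by
  have hcard : #Aᶜ = n - #A := by rw [card_compl, Fintype.card_fin]
  have hm : ∀ X ∈ setCylinder n A, ∀ π : VirtualPerm,
      (merge X π).perm n = placeOn Aᶜ hcard (π.perm (n - #A)) := by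
    intro X hX π
    have h := regularBelow_eq_of_mem hX
    change mergePerm X π n = _
    rw [mergePerm_eq X π n (n - #A) (by rw [h, hcard])]
    congr 1
  split_ifs with hA
  · obtain ⟨ρ, hρ⟩ := placeOn_eq_iff_exists Aᶜ hcard σ (fun x hx => by
      simpa using hA (by simpa using hx))
    exact ⟨{π | π.perm (n - #A) = ρ}, measurableSet_perm fun τ => τ = ρ,
      fun X hX π => by rw [hm X hX, hρ]; rfl, uniformLaw_perm _ _⟩
  · refine ⟨∅, MeasurableSet.empty, fun X hX π => ?_, by simp⟩
    simp only [Set.mem_empty_iff_false, iff_false]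
    rintro rfl
    refine hA fun i hi => ?_
    rw [mem_filter, hm X hX]
    exact ⟨mem_univ _, placeOn_apply_of_notMem _ _ _ (by simpa using hi)⟩

theorem merge_perm_eq_iUnion {n : ℕ} {σ : Equiv.Perm (Fin n)}
    {T : Finset (Fin n) → Set VirtualPerm}
    (hT : ∀ A, ∀ X ∈ setCylinder n A, ∀ π, (merge X π).perm n = σ ↔ π ∈ T A) :
    {x : Set ℕ × VirtualPerm | (merge x.1 x.2).perm n = σ} =
      ⋃ A ∈ (univ : Finset (Finset (Fin n))), setCylinder n A ×ˢ T A := by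
  ext ⟨X, π⟩
  simp only [Set.mem_ofPred_eq, mem_univ, Set.iUnion_true, Set.mem_iUnion, Set.mem_prod]
  constructor
  · intro h
    obtain ⟨A, hA⟩ := exists_mem_setCylinder n X
    exact ⟨A, hA, (hT A X hA π).1 h⟩
  · rintro ⟨A, hA, h⟩
    exact (hT A X hA π).2 h

theorem measurable_merge : Measurable fun x : Set ℕ × VirtualPerm => merge x.1 x.2 := by
  refine measurable_of_perm fun n σ => ?_
  choose T hT using exists_merge_slice σ
  rw [merge_perm_eq_iUnion fun A => (hT A).2.1]
  exact Finset.measurableSet_biUnion _ fun A _ =>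
    (measurableSet_setCylinder n A).prod (hT A).1

instance (ν : Measure (Set ℕ)) [IsProbabilityMeasure ν] : IsProbabilityMeasure (mergeLaw ν) :=
  Measure.isProbabilityMeasure_map measurable_merge.aemeasurable

/-- Only sets `A` of fixed points of `σ` contribute; grouping them by size produces the binomial
coefficients. -/
theorem HasArray.represents_mergeLaw {ν : Measure (Set ℕ)} [IsProbabilityMeasure ν]
    {c : ℕ → ℕ → ℝ} (h : HasArray ν c) : Represents (mergeLaw ν) c := by
  intro n σ
  choose T hT using exists_merge_slice σ
  rw [mergeLaw, map_measureReal_apply measurable_merge (measurableSet_perm fun τ => τ = σ)]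
  change (ν.prod uniformLaw).real {x : Set ℕ × VirtualPerm | (merge x.1 x.2).perm n = σ} = _
  rw [merge_perm_eq_iUnion fun A => (hT A).2.1, measureReal_biUnion_finset]
  · simp only [measureReal_prod_prod, (hT _).2.2, h n, mul_ite, mul_zero]
    rw [← sum_filter]
    have : ({A | A ⊆ ({i | σ i = i} : Finset (Fin n))} : Finset (Finset (Fin n))) =
        ({i | σ i = i} : Finset (Fin n)).powerset := by ext A; simp
    rw [this, sum_powerset_apply_card (fun j => c n j * (1 / ((n - j).factorial : ℝ)))]
    exact sum_congr rfl fun j _ => by rw [nsmul_eq_mul]; simp only [numFixed]; ring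
  · intro A _ B _ hAB
    exact Set.disjoint_prod.2 (Or.inl (disjoint_setCylinder hAB))
  · exact fun A _ => (measurableSet_setCylinder n A).prod (hT A).1

theorem represents_piLaw (α : unitInterval) : Represents (piLaw α) (bernoulliArray α) :=
  (hasArray_setBernoulli α).represents_mergeLaw

instance (α : unitInterval) : IsProbabilityMeasure (piLaw α) :=
  inferInstanceAs (IsProbabilityMeasure (mergeLaw (setBernoulli Set.univ α)))

theorem isSingular_merge {X : Set ℕ} {i : ℕ} (hi : i ∈ X) (π : VirtualPerm) :
    (merge X π).IsSingular i :=
  fun _ _ => placeOn_apply_of_notMem _ _ _ (by rw [mem_regularBelow]; simpa)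

theorem eq_piLaw_iff (α : unitInterval) (P : Measure VirtualPerm) [IsProbabilityMeasure P] :
    P = piLaw α ↔ ∀ (n : ℕ) (σ : Equiv.Perm (Fin n)),
      P.real {π | π.perm n = σ} = probFun α n (numFixed σ) := by
  simp only [← arrayProb_bernoulliArray]
  exact ⟨fun h => h ▸ represents_piLaw α,
    fun h => Represents.eq_of_array h (represents_piLaw α) fun _ _ _ => rfl⟩

/-! ### Restriction to and extension from an initial segment -/

/-- Deletion is not a homomorphism, but it only redirects the value `Fin.last n`, while a right
factor fixing the last element only relabels arguments. -/
theorem deleteLast_mul_insertLast {n : ℕ} (τ : Equiv.Perm (Fin (n + 1))) (s : Equiv.Perm (Fin n)) :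
    deleteLast (τ * insertLast s (Fin.last n)) = deleteLast τ * s := by
  refine Equiv.ext fun i => Fin.castSucc_injective n ?_
  rw [castSucc_deleteLast, Equiv.Perm.mul_apply, Equiv.Perm.mul_apply, Equiv.Perm.mul_apply,
    castSucc_deleteLast, insertLast_last_castSucc, insertLast_last_last]

/-- Deletion of the elements outside `[n]` from a permutation written in cycle notation. -/
def deleteMany {n : ℕ} : (d : ℕ) → Equiv.Perm (Fin (n + d)) → Equiv.Perm (Fin n)
  | 0, τ => τ
  | d + 1, τ => deleteMany d (deleteLast τ)

/-- The extension of a permutation of `[n]` by fixed points. -/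
def extendFixed {n : ℕ} (s : Equiv.Perm (Fin n)) : (d : ℕ) → Equiv.Perm (Fin (n + d))
  | 0 => s
  | d + 1 => insertLast (extendFixed s d) (Fin.last (n + d))

theorem deleteMany_mul_extendFixed {n : ℕ} (s : Equiv.Perm (Fin n)) (d : ℕ)
    (τ : Equiv.Perm (Fin (n + d))) :
    deleteMany d (τ * extendFixed s d) = deleteMany d τ * s := by
  induction d with
  | zero => rfl
  | succ d ih =>
    change deleteMany d (deleteLast (τ * insertLast (extendFixed s d) _)) = _
    rw [deleteLast_mul_insertLast, ih]
    rfl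

theorem extendFixed_castAdd {n : ℕ} (s : Equiv.Perm (Fin n)) (d : ℕ) (i : Fin n) :
    extendFixed s d (Fin.castAdd d i) = Fin.castAdd d (s i) := by
  induction d with
  | zero => rfl
  | succ d ih =>
    have := insertLast_last_castSucc (extendFixed s d) (Fin.castAdd d i)
    rw [ih] at this
    exact this

theorem extendFixed_of_le {n : ℕ} (s : Equiv.Perm (Fin n)) (d : ℕ) (x : Fin (n + d))
    (hx : n ≤ (x : ℕ)) : extendFixed s d x = x := by
  induction d with
  | zero => exact absurd x.2 hx.not_gt
  | succ d ih =>
    change insertLast (extendFixed s d) (Fin.last (n + d)) x = x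
    rcases Fin.eq_castSucc_or_eq_last x with ⟨y, rfl⟩ | rfl
    · rw [insertLast_last_castSucc, ih y (by simpa using hx)]
    · exact insertLast_last_last _

theorem exists_castAdd_or_le {n d : ℕ} (x : Fin (n + d)) :
    (∃ i : Fin n, x = Fin.castAdd d i) ∨ n ≤ (x : ℕ) := by
  rcases Nat.lt_or_ge (x : ℕ) n with h | h
  · exact Or.inl ⟨⟨x, h⟩, rfl⟩
  · exact Or.inr h

theorem le_extendFixed_iff {n d : ℕ} (s : Equiv.Perm (Fin n)) (x : Fin (n + d)) :
    n ≤ (extendFixed s d x : ℕ) ↔ n ≤ (x : ℕ) := by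
  rcases exists_castAdd_or_le x with ⟨i, rfl⟩ | h
  · rw [extendFixed_castAdd, Fin.val_castAdd, Fin.val_castAdd]
    exact iff_of_false (s i).2.not_ge i.2.not_ge
  · rw [extendFixed_of_le s d x h]

namespace VirtualPerm

theorem deleteMany_perm (π : VirtualPerm) (n d : ℕ) : deleteMany d (π.perm (n + d)) = π.perm n := by
  induction d with
  | zero => rfl
  | succ d ih =>
    change deleteMany d (deleteLast (π.perm (n + d + 1))) = _
    rw [π.consistent, ih]

theorem perm_succ_castSucc (π : VirtualPerm) {m : ℕ} (i : Fin m) :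
    π.perm (m + 1) i.castSucc = Fin.last m ∨
      π.perm (m + 1) i.castSucc = (π.perm m i).castSucc := by
  have h := castSucc_deleteLast (π.perm (m + 1)) i
  rw [π.consistent] at h
  split_ifs at h with h'
  · exact Or.inl h'
  · exact Or.inr h.symm

/-- Deleting other elements leaves a singleton cycle alone. -/
theorem fixed_of_le (π : VirtualPerm) {i m m' : ℕ} (h : i < m) (hm : m ≤ m')
    (e : π.perm m' ⟨i, h.trans_le hm⟩ = ⟨i, h.trans_le hm⟩) : π.perm m ⟨i, h⟩ = ⟨i, h⟩ := by
  induction hm with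
  | refl => exact e
  | step hm ih =>
    rename_i k
    have hk : i < k := h.trans_le hm
    refine ih ?_
    have e' : π.perm (k + 1) (Fin.castSucc ⟨i, hk⟩) = Fin.castSucc ⟨i, hk⟩ := e
    rcases π.perm_succ_castSucc ⟨i, hk⟩ with h1 | h1
    · rw [e'] at h1
      exact absurd h1 (Fin.castSucc_lt_last _).ne
    · rw [e'] at h1
      exact (Fin.castSucc_injective _ h1).symm

/-- The images of an element of `[n]` finally leave `[n]`, or they never change from `n` on. -/
theorem eventually_le_or_const (π : VirtualPerm) {n : ℕ} (i : Fin n) :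
    (∀ᶠ d in Filter.atTop, n ≤ (π.perm (n + d) (Fin.castAdd d i) : ℕ)) ∨
      ∃ j : Fin n, ∀ d, π.perm (n + d) (Fin.castAdd d i) = Fin.castAdd d j := by
  have step : ∀ d, π.perm (n + d + 1) (Fin.castAdd (d + 1) i) = Fin.last (n + d) ∨
      π.perm (n + d + 1) (Fin.castAdd (d + 1) i) = (π.perm (n + d) (Fin.castAdd d i)).castSucc :=
    fun d => π.perm_succ_castSucc (Fin.castAdd d i)
  by_cases h : ∃ d, n ≤ (π.perm (n + d) (Fin.castAdd d i) : ℕ)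
  · left
    obtain ⟨d₀, h₀⟩ := h
    filter_upwards [Filter.eventually_ge_atTop d₀] with d hd
    induction d, hd using Nat.le_induction with
    | base => exact h₀
    | succ d _ ih =>
      change n ≤ (π.perm (n + d + 1) (Fin.castAdd (d + 1) i) : ℕ)
      rcases step d with h | h
      · rw [h]; simp
      · rw [h]; simpa using ih
  · right
    push Not at h
    refine ⟨π.perm n i, fun d => ?_⟩
    induction d with
    | zero => rfl
    | succ d ih =>
      rcases step d with h1 | h1
      · have h2 : (π.perm (n + d + 1) (Fin.castAdd (d + 1) i) : ℕ) < n := h (d + 1)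
        rw [h1] at h2
        simp at h2
      · change π.perm (n + d + 1) (Fin.castAdd (d + 1) i) = _
        rw [h1, ih]; rfl

theorem isSingular_of_const (π : VirtualPerm) {n : ℕ} {i : Fin n}
    (h : ∀ d, π.perm (n + d) (Fin.castAdd d i) = Fin.castAdd d i) : π.IsSingular i := by
  intro m hm
  refine π.fixed_of_le hm (Nat.le_add_left m n) ?_
  exact h m

/-- The set of singular elements. -/
def singularSet (π : VirtualPerm) : Set ℕ := {i | π.IsSingular i}

theorem measurable_singularSet : Measurable singularSet := by
  rw [measurable_set_iff]
  intro i
  rw [← measurableSet_setOfPred]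
  have : {π : VirtualPerm | i ∈ π.singularSet} =
      ⋂ (n : ℕ) (h : i < n), {π : VirtualPerm | π.perm n ⟨i, h⟩ = ⟨i, h⟩} := by
    ext π; simp [singularSet, IsSingular]
  rw [this]
  exact MeasurableSet.iInter fun n => MeasurableSet.iInter fun h =>
    measurableSet_perm fun τ => τ ⟨i, h⟩ = ⟨i, h⟩

end VirtualPerm

/-! ### Infinitely spherically symmetric laws -/

open VirtualPerm

theorem measureReal_perm_eq_sum (P : Measure VirtualPerm) [IsProbabilityMeasure P] {m : ℕ}
    (T : Equiv.Perm (Fin m) → Prop) [DecidablePred T] :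
    P.real {π | T (π.perm m)} = ∑ τ, if T τ then P.real {π | π.perm m = τ} else 0 := by
  have : {π : VirtualPerm | T (π.perm m)} =
      ⋃ τ ∈ (univ.filter T : Finset (Equiv.Perm (Fin m))), {π | π.perm m = τ} := by
    ext π; simp
  rw [this, measureReal_biUnion_finset, sum_filter]
  · intro σ _ τ _ h
    exact Set.disjoint_left.2 fun π h1 h2 => h (h1.symm.trans h2)
  · exact fun τ _ => measurableSet_perm fun ρ => ρ = τ

/-- The length has to be preserved on `T` only, which admits right multiplications as well as
conjugations. -/
theorem IsISS.measureReal_eq {P : Measure VirtualPerm} [IsProbabilityMeasure P] (hP : IsISS P)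
    {m : ℕ} (e : Equiv.Perm (Fin m) ≃ Equiv.Perm (Fin m)) {T T' : Equiv.Perm (Fin m) → Prop}
    (h : ∀ τ, T τ ↔ T' (e τ)) (hl : ∀ τ, T τ → hammingLength (e τ) = hammingLength τ) :
    P.real {π | T (π.perm m)} = P.real {π | T' (π.perm m)} := by
  classical
  rw [measureReal_perm_eq_sum, measureReal_perm_eq_sum]
  refine Fintype.sum_equiv e _ _ fun τ => ?_
  by_cases hT : T τ
  · rw [if_pos hT, if_pos ((h τ).1 hT), measureReal_def, measureReal_def,
      hP m _ _ (hl τ hT)]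
  · rw [if_neg hT, if_neg (fun h' => hT ((h τ).2 h'))]

theorem IsISS.measureReal_conj {P : Measure VirtualPerm} [IsProbabilityMeasure P] (hP : IsISS P)
    {m : ℕ} (g : Equiv.Perm (Fin m)) (T : Equiv.Perm (Fin m) → Prop) :
    P.real {π | T (g * π.perm m * g⁻¹)} = P.real {π | T (π.perm m)} :=
  hP.measureReal_eq (MulAut.conj g).toEquiv (fun _ => Iff.rfl) fun τ _ => hammingLength_conj g τ

/-- Conjugation by transpositions that fix `a` makes the `m - 1` images other than `a` equally
likely. -/
theorem IsISS.apply_eq_le {P : Measure VirtualPerm} [IsProbabilityMeasure P] (hP : IsISS P)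
    {m : ℕ} {a b : Fin m} (hab : a ≠ b) :
    P.real {π | π.perm m a = b} * ((m : ℝ) - 1) ≤ 1 := by
  have h1 : ∀ c ∈ univ.erase a, P.real {π | π.perm m a = c} = P.real {π | π.perm m a = b} := by
    intro c hc
    have hca : a ≠ c := (ne_of_mem_erase hc).symm
    rw [← hP.measureReal_conj (Equiv.swap b c) fun τ => τ a = c]
    congr 1
    ext π
    simp [Equiv.swap_apply_of_ne_of_ne hab hca, Equiv.swap_apply_eq_iff]
  have h2 : ∑ c ∈ univ.erase a, P.real {π | π.perm m a = c} ≤ 1 := by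
    rw [← measureReal_biUnion_finset]
    · exact measureReal_le_one
    · intro c _ c' _ h
      exact Set.disjoint_left.2 fun π h1 h2 => h (h1.symm.trans h2)
    · exact fun c _ => measurableSet_perm fun τ => τ a = c
  rw [sum_congr rfl h1, sum_const, card_erase_of_mem (mem_univ a), card_univ, Fintype.card_fin,
    nsmul_eq_mul, Nat.cast_sub (by have := a.2; omega)] at h2
  rw [mul_comm]; simpa using h2

theorem IsISS.const_null {P : Measure VirtualPerm} [IsProbabilityMeasure P] (hP : IsISS P)
    {n : ℕ} {i j : Fin n} (hij : i ≠ j) :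
    P {π | ∀ d, π.perm (n + d) (Fin.castAdd d i) = Fin.castAdd d j} = 0 := by
  rw [← measureReal_eq_zero_iff]
  by_contra hne
  have hpos := lt_of_le_of_ne measureReal_nonneg (Ne.symm hne)
  set p := P.real {π | ∀ d, π.perm (n + d) (Fin.castAdd d i) = Fin.castAdd d j}
  obtain ⟨N, hN⟩ := exists_nat_gt (1 / p + 1)
  have h1 := hP.apply_eq_le (m := n + N) (a := Fin.castAdd N i) (b := Fin.castAdd N j)
    (fun h => hij (Fin.castAdd_injective _ _ h))
  have h2 : p ≤ P.real {π | π.perm (n + N) (Fin.castAdd N i) = Fin.castAdd N j} :=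
    measureReal_mono fun π hπ => hπ N
  have h3 : 1 / p < ((n + N : ℕ) : ℝ) - 1 := by
    push_cast
    have : (0 : ℝ) ≤ n := Nat.cast_nonneg n
    linarith
  rw [div_lt_iff₀ hpos] at h3
  have : 0 ≤ ((n + N : ℕ) : ℝ) - 1 := by
    have : 0 < 1 / p := by positivity
    nlinarith
  nlinarith

theorem IsISS.ae_singular_or_le {P : Measure VirtualPerm} [IsProbabilityMeasure P] (hP : IsISS P)
    (n : ℕ) : ∀ᵐ π ∂P, ∀ i : Fin n, π.IsSingular i ∨
      ∀ᶠ d in Filter.atTop, n ≤ (π.perm (n + d) (Fin.castAdd d i) : ℕ) := by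
  have h : ∀ᵐ π ∂P, ∀ i j : Fin n, i ≠ j →
      ¬ ∀ d, π.perm (n + d) (Fin.castAdd d i) = Fin.castAdd d j := by
    rw [ae_all_iff]; intro i
    rw [ae_all_iff]; intro j
    rw [ae_all_iff]; intro hij
    rw [ae_iff]
    simpa using hP.const_null hij
  filter_upwards [h] with π hπ i
  rcases π.eventually_le_or_const i with h | ⟨j, hj⟩
  · exact Or.inr h
  · by_cases hij : i = j
    · subst hij
      exact Or.inl (π.isSingular_of_const hj)
    · exact absurd hj (hπ i j hij)

/-- The permutation fixes `A ⊆ [n]`, and maps `[n] \ A` to elements outside `[n]`. -/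
def FixesAndExpels {n : ℕ} (A : Finset (Fin n)) (d : ℕ) (τ : Equiv.Perm (Fin (n + d))) : Prop :=
  (∀ i ∈ A, τ (Fin.castAdd d i) = Fin.castAdd d i) ∧
    ∀ i ∉ A, n ≤ (τ (Fin.castAdd d i) : ℕ)

/-- Spherical symmetry speaks of one permutation at a time, whereas singularity involves all levels.
The indicators converge almost surely by `IsISS.ae_singular_or_le`. -/
theorem IsISS.tendsto_fixesAndExpels {P : Measure VirtualPerm} [IsProbabilityMeasure P]
    (hP : IsISS P) {n : ℕ} (A : Finset (Fin n)) (p : Equiv.Perm (Fin n) → Prop) :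
    Filter.Tendsto (fun d => P.real {π | p (π.perm n) ∧ FixesAndExpels A d (π.perm (n + d))})
      Filter.atTop (nhds (P.real {π | p (π.perm n) ∧ π.singularSet ∈ setCylinder n A})) := by
  simp only [measureReal_def]
  refine (ENNReal.tendsto_toReal (measure_ne_top _ _)).comp
    (tendsto_measure_of_ae_tendsto_indicator_of_isFiniteMeasure _ ?_ (fun d => ?_) ?_)
  · exact (measurableSet_perm p).inter
      (measurable_singularSet (measurableSet_setCylinder n A))
  · exact (measurableSet_perm p).inter (measurableSet_perm fun τ => FixesAndExpels A d τ)
  · filter_upwards [hP.ae_singular_or_le n] with π hπ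
    have h : ∀ i : Fin n, ∀ᶠ d in Filter.atTop, π.IsSingular i ∨
        n ≤ (π.perm (n + d) (Fin.castAdd d i) : ℕ) := by
      intro i
      rcases hπ i with h | h
      · exact Filter.Eventually.of_forall fun _ => Or.inl h
      · exact h.mono fun _ => Or.inr
    filter_upwards [Filter.eventually_all.2 h] with d hd
    have hfix : ∀ i : Fin n, π.IsSingular i →
        π.perm (n + d) (Fin.castAdd d i) = Fin.castAdd d i := fun i hi => hi _ _
    have hne : ∀ i : Fin n, π.perm (n + d) (Fin.castAdd d i) = Fin.castAdd d i →
        ¬ n ≤ (π.perm (n + d) (Fin.castAdd d i) : ℕ) := by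
      intro i hi
      rw [hi]; simp
    refine and_congr_right fun _ => ⟨fun ⟨h1, h2⟩ i => ⟨fun hi => ?_, fun hi => ?_⟩,
      fun h => ⟨fun i hi => hfix i ((h i).2 hi), fun i hi => ?_⟩⟩
    · by_contra hiA
      exact hne i (hfix i hi) (h2 i hiA)
    · exact (hd i).resolve_right (hne i (h1 i hi))
    · exact (hd i).resolve_left fun h' => hi ((h i).1 h')

/-- At level `n + d`, when `[n] \ A` is expelled from `[n]`, none of its elements is fixed, before
or after composing with `s` on the right. So the fixed points, hence the length, are unchanged, and
the limit in `d` is taken. -/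
theorem IsISS.measureReal_mul_eq {P : Measure VirtualPerm} [IsProbabilityMeasure P]
    (hP : IsISS P) {n : ℕ} (A : Finset (Fin n)) (σ s : Equiv.Perm (Fin n))
    (hs : ∀ i ∈ A, s i = i) :
    P.real {π | π.perm n = σ ∧ π.singularSet ∈ setCylinder n A} =
      P.real {π | π.perm n = σ * s ∧ π.singularSet ∈ setCylinder n A} := by
  refine tendsto_nhds_unique (hP.tendsto_fixesAndExpels A fun τ => τ = σ) ?_
  refine (hP.tendsto_fixesAndExpels A fun τ => τ = σ * s).congr fun d => ?_
  have hsA : ∀ i, s i ∈ A ↔ i ∈ A := by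
    intro i
    refine ⟨fun h => ?_, fun h => by rwa [hs i h]⟩
    have := s.injective (hs _ h)
    rwa [this] at h
  have e : ∀ ρ : Equiv.Perm (Fin n),
      {π : VirtualPerm | π.perm n = ρ ∧ FixesAndExpels A d (π.perm (n + d))} =
      {π | deleteMany d (π.perm (n + d)) = ρ ∧ FixesAndExpels A d (π.perm (n + d))} := by
    intro ρ; ext π; simp only [Set.mem_ofPred_eq, deleteMany_perm]
  rw [e, e]
  symm
  refine hP.measureReal_eq (Equiv.mulRight (extendFixed s d))
    (T := fun τ => deleteMany d τ = σ ∧ FixesAndExpels A d τ)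
    (T' := fun τ => deleteMany d τ = σ * s ∧ FixesAndExpels A d τ) (fun τ => ?_) fun τ hτ => ?_
  · rw [Equiv.coe_mulRight, deleteMany_mul_extendFixed, mul_left_inj]
    refine and_congr_right fun _ => ?_
    simp only [FixesAndExpels, Equiv.Perm.mul_apply, extendFixed_castAdd]
    refine and_congr (forall₂_congr fun i hi => by rw [hs i hi]) ⟨fun h i hi => ?_, fun h i hi => ?_⟩
    · exact h _ (by rwa [hsA])
    · have := h (s.symm i) (by rwa [← hsA, Equiv.apply_symm_apply])
      rwa [Equiv.apply_symm_apply] at this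
  · refine hammingLength_eq_of_fixed_iff fun x => ?_
    rw [Equiv.coe_mulRight, Equiv.Perm.mul_apply]
    rcases exists_castAdd_or_le x with ⟨i, rfl⟩ | h
    · rw [extendFixed_castAdd]
      by_cases hi : i ∈ A
      · rw [hs i hi]
      · have h1 := hτ.2.2 i hi
        have h2 := hτ.2.2 (s i) (by rwa [hsA])
        have hlt : ((Fin.castAdd d i : Fin (n + d)) : ℕ) < n := i.2
        exact iff_of_false (fun h3 => by rw [h3] at h2; omega) (fun h3 => by rw [h3] at h1; omega)
    · rw [extendFixed_of_le s d x h]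

/-- Exchangeability of the singular set: conjugating by the extension of `g` carries the
approximating event of `A` to that of its image. -/
theorem IsISS.measureReal_map_eq {P : Measure VirtualPerm} [IsProbabilityMeasure P]
    (hP : IsISS P) {n : ℕ} (A : Finset (Fin n)) (g : Equiv.Perm (Fin n)) :
    P.real {π | π.singularSet ∈ setCylinder n (A.map g.toEmbedding)} =
      P.real {π | π.singularSet ∈ setCylinder n A} := by
  have h1 := hP.tendsto_fixesAndExpels A fun _ => True
  have h2 := hP.tendsto_fixesAndExpels (A.map g.toEmbedding) fun _ => True
  simp only [true_and] at h1 h2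
  refine tendsto_nhds_unique h2 (h1.congr fun d => ?_)
  rw [← hP.measureReal_conj (extendFixed g d) (FixesAndExpels (A.map g.toEmbedding) d)]
  congr 1
  ext π
  have hg : ∀ i : Fin n, (extendFixed g d)⁻¹ (Fin.castAdd d (g i)) = Fin.castAdd d i := by
    intro i
    rw [Equiv.Perm.inv_eq_iff_eq, extendFixed_castAdd]
  simp only [Set.mem_ofPred_eq, FixesAndExpels, Equiv.Perm.mul_apply]
  refine and_congr ?_ ?_
  · simp only [mem_map, Equiv.coe_toEmbedding, forall_exists_index, and_imp,
      forall_apply_eq_imp_iff₂, hg]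
    refine forall₂_congr fun i _ => ?_
    rw [← extendFixed_castAdd, (extendFixed g d).injective.eq_iff]
  · simp only [le_extendFixed_iff]
    refine ⟨fun h i hi => ?_, fun h i hi => ?_⟩
    · obtain ⟨i, rfl⟩ := g.surjective i
      rw [hg]
      exact h i fun h' => hi (mem_map_of_mem g.toEmbedding h')
    · have := h (g i) (by simpa using hi)
      rwa [hg] at this

theorem card_perm_fixing {n : ℕ} (A : Finset (Fin n)) :
    #{τ : Equiv.Perm (Fin n) | ∀ i ∈ A, τ i = i} = (n - #A).factorial := by
  have h := Fintype.card_congr (Equiv.Perm.subtypeEquivSubtypePerm fun i : Fin n => i ∉ A)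
  rw [Fintype.card_perm, Fintype.card_subtype_compl (fun i => i ∈ A), Fintype.card_fin,
    Fintype.card_coe] at h
  rw [h, Fintype.card_subtype]
  simp

theorem exists_perm_map_eq {n : ℕ} {A B : Finset (Fin n)} (h : #A = #B) :
    ∃ g : Equiv.Perm (Fin n), A.map g.toEmbedding = B := by
  let e : {x // x ∈ A} ≃ {x // x ∈ B} := equivOfCardEq h
  refine ⟨e.extendSubtype, eq_of_subset_of_card_le (fun x hx => ?_) (by rw [card_map, h])⟩
  obtain ⟨y, hy, rfl⟩ := mem_map.1 hx
  exact e.extendSubtype_mem y hy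

/-- The probability that exactly the first `j` elements of `[n]` are singular. -/
noncomputable def singularArray (P : Measure VirtualPerm) (n j : ℕ) : ℝ :=
  P.real {π | π.singularSet ∈ setCylinder n {i | (i : ℕ) < j}}

theorem IsISS.hasArray {P : Measure VirtualPerm} [IsProbabilityMeasure P] (hP : IsISS P) :
    HasArray (P.map singularSet) (singularArray P) := by
  intro n A
  rw [map_measureReal_apply measurable_singularSet (measurableSet_setCylinder n A)]
  have hA : #A = #({i | (i : ℕ) < #A} : Finset (Fin n)) := by
    have : #A ≤ n := by simpa using card_le_univ A
    rw [Fin.card_filter_val_lt, min_eq_right this]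
  obtain ⟨g, hg⟩ := exists_perm_map_eq hA
  rw [singularArray, ← hg, hP.measureReal_map_eq]
  rfl

instance (P : Measure VirtualPerm) [IsProbabilityMeasure P] :
    IsProbabilityMeasure (P.map singularSet) :=
  Measure.isProbabilityMeasure_map measurable_singularSet.aemeasurable

theorem IsISS.isPascalArray {P : Measure VirtualPerm} [IsProbabilityMeasure P] (hP : IsISS P) :
    IsPascalArray (singularArray P) :=
  hP.hasArray.isPascalArray

theorem IsISS.measureReal_singular {P : Measure VirtualPerm} [IsProbabilityMeasure P]
    (hP : IsISS P) {n : ℕ} (A : Finset (Fin n)) :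
    P.real {π | π.singularSet ∈ setCylinder n A} = singularArray P n #A := by
  rw [← hP.hasArray, map_measureReal_apply measurable_singularSet (measurableSet_setCylinder n A)]
  rfl

theorem measurableSet_perm_singular {n : ℕ} (σ : Equiv.Perm (Fin n)) (A : Finset (Fin n)) :
    MeasurableSet {π : VirtualPerm | π.perm n = σ ∧ π.singularSet ∈ setCylinder n A} :=
  (measurableSet_perm fun τ => τ = σ).inter
    (measurable_singularSet (measurableSet_setCylinder n A))

theorem measureReal_perm_singular_eq_zero (P : Measure VirtualPerm) {n : ℕ}
    {σ : Equiv.Perm (Fin n)} {A : Finset (Fin n)} (h : ¬ ∀ i ∈ A, σ i = i) :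
    P.real {π | π.perm n = σ ∧ π.singularSet ∈ setCylinder n A} = 0 := by
  have : {π : VirtualPerm | π.perm n = σ ∧ π.singularSet ∈ setCylinder n A} = ∅ := by
    ext π
    simp only [Set.mem_ofPred_eq, Set.mem_empty_iff_false, iff_false, not_and]
    rintro rfl hA
    exact h fun i hi => (hA i).2 hi n i.2
  rw [this, measureReal_empty]

/-- Given the singular elements of `[n]`, the permutation of the regular ones is uniform. -/
theorem IsISS.measureReal_perm_singular {P : Measure VirtualPerm} [IsProbabilityMeasure P]
    (hP : IsISS P) {n : ℕ} {σ : Equiv.Perm (Fin n)} {A : Finset (Fin n)}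
    (hσ : ∀ i ∈ A, σ i = i) :
    P.real {π | π.perm n = σ ∧ π.singularSet ∈ setCylinder n A} =
      singularArray P n #A / ((n - #A).factorial : ℝ) := by
  rw [eq_div_iff (by positivity), ← hP.measureReal_singular]
  have e : {π : VirtualPerm | π.singularSet ∈ setCylinder n A} =
      ⋃ τ ∈ (univ : Finset (Equiv.Perm (Fin n))),
        {π | π.perm n = τ ∧ π.singularSet ∈ setCylinder n A} := by
    ext π; simp
  have h : ∀ τ : Equiv.Perm (Fin n),
      P.real {π | π.perm n = τ ∧ π.singularSet ∈ setCylinder n A} =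
      if ∀ i ∈ A, τ i = i then
        P.real {π | π.perm n = σ ∧ π.singularSet ∈ setCylinder n A} else 0 := by
    intro τ
    split_ifs with hτ
    -- Both permutations fix `A`, so the factor `σ⁻¹ * τ` that leads from one to the other does too.
    · rw [hP.measureReal_mul_eq A σ (σ⁻¹ * τ) fun i hi => by
        rw [Equiv.Perm.mul_apply, hτ i hi, Equiv.Perm.inv_eq_iff_eq, hσ i hi], mul_inv_cancel_left]
    · exact measureReal_perm_singular_eq_zero P hτ
  rw [e, measureReal_biUnion_finset]
  · rw [sum_congr rfl fun τ _ => h τ, ← sum_filter, sum_const, card_perm_fixing, nsmul_eq_mul,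
      mul_comm]
  · intro τ _ τ' _ hne
    exact Set.disjoint_left.2 fun π h1 h2 => hne (h1.1.symm.trans h2.1)
  · exact fun τ _ => measurableSet_perm_singular τ A

theorem IsISS.represents {P : Measure VirtualPerm} [IsProbabilityMeasure P] (hP : IsISS P) :
    Represents P (singularArray P) := by
  intro n σ
  have e : {π : VirtualPerm | π.perm n = σ} =
      ⋃ A ∈ (univ : Finset (Finset (Fin n))),
        {π | π.perm n = σ ∧ π.singularSet ∈ setCylinder n A} := by
    ext π
    simp [exists_mem_setCylinder]
  have h : ∀ A : Finset (Fin n),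
      P.real {π | π.perm n = σ ∧ π.singularSet ∈ setCylinder n A} =
      if A ⊆ ({i | σ i = i} : Finset (Fin n)) then
        singularArray P n #A / ((n - #A).factorial : ℝ) else 0 := by
    intro A
    have hA : A ⊆ ({i | σ i = i} : Finset (Fin n)) ↔ ∀ i ∈ A, σ i = i := by
      simp [subset_iff]
    simp only [hA]
    split_ifs with hσ
    · exact hP.measureReal_perm_singular hσ
    · exact measureReal_perm_singular_eq_zero P hσ
  rw [e, measureReal_biUnion_finset]
  · rw [sum_congr rfl fun A _ => h A, ← sum_filter]
    have : ({A | A ⊆ ({i | σ i = i} : Finset (Fin n))} : Finset (Finset (Fin n))) =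
        ({i | σ i = i} : Finset (Fin n)).powerset := by ext A; simp
    rw [this, sum_powerset_apply_card
      (fun j => singularArray P n j / ((n - j).factorial : ℝ))]
    exact sum_congr rfl fun j _ => by rw [nsmul_eq_mul]; simp only [numFixed]; ring
  · intro A _ B _ hne
    exact Set.disjoint_left.2 fun π h1 h2 => Set.disjoint_left.1 (disjoint_setCylinder hne) h1.2 h2.2
  · exact fun A _ => measurableSet_perm_singular σ A

theorem isISS_piLaw (α : unitInterval) : IsISS (piLaw α) := (represents_piLaw α).isISS

theorem isPascalArray_bernoulliArray_coe (α : unitInterval) : IsPascalArray (bernoulliArray α) :=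
  isPascalArray_bernoulliArray α.2.1 α.2.2

/-! ### The singular elements of the enriched law -/

theorem setOf_mem_eq_iUnion (i : ℕ) : {X : Set ℕ | i ∈ X} =
    ⋃ A ∈ ({A | Fin.last i ∈ A} : Finset (Finset (Fin (i + 1)))), setCylinder (i + 1) A := by
  ext X
  simp only [Set.mem_ofPred_eq, mem_filter, mem_univ, true_and, Set.mem_iUnion, exists_prop]
  constructor
  · intro h
    obtain ⟨A, hA⟩ := exists_mem_setCylinder (i + 1) X
    exact ⟨A, (hA (Fin.last i)).1 h, hA⟩
  · rintro ⟨A, h, hA⟩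
    exact (hA (Fin.last i)).2 h

theorem HasArray.measureReal_mem {ν : Measure (Set ℕ)} [IsProbabilityMeasure ν] {c : ℕ → ℕ → ℝ}
    (h : HasArray ν c) (i : ℕ) : ν.real {X | i ∈ X} =
      ∑ A ∈ ({A | Fin.last i ∈ A} : Finset (Finset (Fin (i + 1)))), c (i + 1) #A := by
  rw [setOf_mem_eq_iUnion, measureReal_biUnion_finset]
  · exact sum_congr rfl fun A _ => h _ _
  · exact fun A _ B _ hAB => disjoint_setCylinder hAB
  · exact fun A _ => measurableSet_setCylinder _ A

/-- The law is represented by the array of its singular set and by that of the marks; uniqueness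
identifies the two. -/
theorem piLaw_isSingular (α : unitInterval) (i : ℕ) :
    (piLaw α).real {π | π.IsSingular i} = (setBernoulli Set.univ α).real {X : Set ℕ | i ∈ X} := by
  have h := (isISS_piLaw α).hasArray.measureReal_mem i
  rw [map_measureReal_apply measurable_singularSet (measurableSet_mem i)] at h
  rw [(hasArray_setBernoulli α).measureReal_mem i]
  refine h.trans (sum_congr rfl fun A _ => ?_)
  exact (isISS_piLaw α).represents.array_eq (represents_piLaw α) (isISS_piLaw α).isPascalArray
    (isPascalArray_bernoulliArray_coe α) (by simpa using card_le_univ A)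

instance (α : unitInterval) : IsProbabilityMeasure (enrichedLaw α) := by
  unfold enrichedLaw; infer_instance

/-- For each element, being marked implies being singular and has the same probability, so the
difference is null; there are countably many elements. -/
theorem ae_singularSet_eq (α : unitInterval) :
    ∀ᵐ x ∂(enrichedLaw α), {i | (merge x.1 x.2).IsSingular i} = x.1 := by
  have key : ∀ i : ℕ, ∀ᵐ x ∂(enrichedLaw α), (merge x.1 x.2).IsSingular i → i ∈ x.1 := by
    intro i
    have hmS : MeasurableSet {π : VirtualPerm | π.IsSingular i} :=
      measurable_singularSet (measurableSet_mem i)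
    have h1 : (enrichedLaw α).real {x | (merge x.1 x.2).IsSingular i} =
        (setBernoulli Set.univ α).real {X : Set ℕ | i ∈ X} := by
      rw [← piLaw_isSingular, piLaw, map_measureReal_apply measurable_merge hmS]
      rfl
    have h2 : (enrichedLaw α).real {x | i ∈ x.1} =
        (setBernoulli Set.univ α).real {X : Set ℕ | i ∈ X} := by
      have e : {x : Set ℕ × VirtualPerm | i ∈ x.1} = {X : Set ℕ | i ∈ X} ×ˢ Set.univ := by
        ext x; simp
      rw [e, enrichedLaw, measureReal_prod_prod]
      simp
    have hm : MeasurableSet {x : Set ℕ × VirtualPerm | i ∈ x.1} :=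
      measurable_fst (measurableSet_mem i)
    have h3 := measureReal_sdiff (μ := enrichedLaw α)
      (show {x : Set ℕ × VirtualPerm | i ∈ x.1} ⊆ {x | (merge x.1 x.2).IsSingular i} from
        fun x hx => isSingular_merge hx x.2) hm
    rw [h1, h2, sub_self, measureReal_eq_zero_iff] at h3
    rw [ae_iff]
    refine measure_mono_null (fun x hx => ?_) h3
    rw [Set.mem_ofPred_eq, Classical.not_imp] at hx
    exact hx
  filter_upwards [ae_all_iff.2 key] with x hx
  exact Set.ext fun i => ⟨hx i, fun hi => isSingular_merge hi x.2⟩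

/-! ### Extreme laws -/

theorem isProbabilityMeasure_convexComb {Ω : Type*} [MeasurableSpace Ω] (P Q : Measure Ω)
    [IsProbabilityMeasure P] [IsProbabilityMeasure Q] {a b : ℝ≥0} (hab : a + b = 1) :
    IsProbabilityMeasure (a • P + b • Q) :=
  ⟨by
    rw [Measure.add_apply, Measure.smul_apply, Measure.smul_apply, measure_univ, measure_univ,
      ENNReal.smul_def, ENNReal.smul_def, smul_eq_mul, smul_eq_mul, mul_one, mul_one,
      ← ENNReal.coe_add, hab, ENNReal.coe_one]⟩

theorem Represents.convexComb {P Q : Measure VirtualPerm} [IsProbabilityMeasure P]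
    [IsProbabilityMeasure Q] {c c' : ℕ → ℕ → ℝ} (hP : Represents P c) (hQ : Represents Q c')
    (a b : ℝ≥0) : Represents (a • P + b • Q) fun n j => a * c n j + b * c' n j := by
  intro n σ
  rw [measureReal_add_apply, measureReal_nnreal_smul_apply, measureReal_nnreal_smul_apply, hP, hQ,
    arrayProb_linear]

theorem IsPascalArray.convexComb {c c' : ℕ → ℕ → ℝ} (hc : IsPascalArray c)
    (hc' : IsPascalArray c') {a b : ℝ≥0} (hab : a + b = 1) :
    IsPascalArray fun n j => a * c n j + b * c' n j where
  zero := by rw [hc.zero, hc'.zero, mul_one, mul_one]; exact_mod_cast hab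
  nonneg h := add_nonneg (mul_nonneg a.2 (hc.nonneg h)) (mul_nonneg b.2 (hc'.nonneg h))
  pascal h := by rw [hc.pascal h, hc'.pascal h]; ring

/-- A component of weight `a` has an array at most `a⁻¹` times the Bernoulli array. -/
theorem piLaw_mem_extremePoints (α : unitInterval) :
    piLaw α ∈ Set.extremePoints ℝ≥0 issLaws := by
  refine ⟨⟨inferInstance, isISS_piLaw α⟩, ?_⟩
  rintro P ⟨hP, hPi⟩ Q ⟨hQ, hQi⟩ ⟨a, b, ha, hb, hab, h⟩
  have hrep := hPi.represents.convexComb hQi.represents a b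
  rw [h] at hrep
  have hc := hPi.isPascalArray
  have hc' := hQi.isPascalArray
  refine hPi.represents.eq_of_array (represents_piLaw α) fun n j hj => ?_
  refine hc.eq_bernoulliArray_of_le α (K := (a : ℝ)⁻¹) (fun n j hj => ?_) hj
  have ha' : (0 : ℝ) < a := ha
  rw [le_inv_mul_iff₀ ha', (represents_piLaw α).array_eq hrep (isPascalArray_bernoulliArray_coe α)
    (hc.convexComb hc' hab) hj]
  have := mul_nonneg b.2 (hc'.nonneg hj)
  exact le_add_of_nonneg_right this

/-- The set of the predecessors of the positive elements. -/
def shiftSet (X : Set ℕ) : Set ℕ := {i | i + 1 ∈ X}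

theorem measurable_shiftSet : Measurable shiftSet :=
  measurable_set_iff.2 fun i => measurable_set_mem (i + 1)

theorem setCylinder_univ_inter_shiftSet (n : ℕ) (A : Finset (Fin n)) :
    setCylinder 1 univ ∩ shiftSet ⁻¹' setCylinder n A =
      setCylinder (n + 1) (insert 0 (A.map (Fin.succEmb n))) := by
  ext X
  simp [setCylinder, shiftSet, Fin.forall_fin_succ]

theorem setCylinder_empty_inter_shiftSet (n : ℕ) (A : Finset (Fin n)) :
    setCylinder 1 ∅ ∩ shiftSet ⁻¹' setCylinder n A = setCylinder (n + 1) (A.map (Fin.succEmb n)) := by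
  ext X
  simp [setCylinder, shiftSet, Fin.forall_fin_succ]

/-- `setCylinder 1 univ` is the event that the first element belongs to the set; the remaining
elements stay exchangeable given it. -/
theorem HasArray.cond_univ {ν : Measure (Set ℕ)} {c : ℕ → ℕ → ℝ} (h : HasArray ν c) :
    HasArray ((cond ν (setCylinder 1 univ)).map shiftSet)
      fun n j => (c 1 1)⁻¹ * c (n + 1) (j + 1) := by
  intro n A
  rw [map_measureReal_apply measurable_shiftSet (measurableSet_setCylinder n A),
    measureReal_def, cond_apply (measurableSet_setCylinder _ _), ENNReal.toReal_mul,
    ENNReal.toReal_inv, ← measureReal_def, ← measureReal_def, setCylinder_univ_inter_shiftSet, h, h,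
    card_insert_of_notMem (by simp), card_map]
  simp

theorem HasArray.cond_empty {ν : Measure (Set ℕ)} {c : ℕ → ℕ → ℝ} (h : HasArray ν c) :
    HasArray ((cond ν (setCylinder 1 ∅)).map shiftSet)
      fun n j => (c 1 0)⁻¹ * c (n + 1) j := by
  intro n A
  rw [map_measureReal_apply measurable_shiftSet (measurableSet_setCylinder n A),
    measureReal_def, cond_apply (measurableSet_setCylinder _ _), ENNReal.toReal_mul,
    ENNReal.toReal_inv, ← measureReal_def, ← measureReal_def, setCylinder_empty_inter_shiftSet, h, h,
    card_map]
  simp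

theorem isProbabilityMeasure_cond_shiftSet {ν : Measure (Set ℕ)} [IsProbabilityMeasure ν]
    {c : ℕ → ℕ → ℝ} (h : HasArray ν c) {A : Finset (Fin 1)} (hA : c 1 #A ≠ 0) :
    IsProbabilityMeasure ((cond ν (setCylinder 1 A)).map shiftSet) := by
  have : IsProbabilityMeasure (cond ν (setCylinder 1 A)) := by
    refine cond_isProbabilityMeasure fun h0 => hA ?_
    rw [← h, measureReal_def, h0, ENNReal.toReal_zero]
  exact Measure.isProbabilityMeasure_map measurable_shiftSet.aemeasurable

theorem IsPascalArray.one_one_add {c : ℕ → ℕ → ℝ} (hc : IsPascalArray c) :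
    c 1 1 + c 1 0 = 1 := by
  have := hc.pascal (le_refl 0)
  rw [hc.zero] at this
  simp only [zero_add] at this
  linarith

/-- `c 1 1` is a combination of these nonnegative entries with positive coefficients. -/
theorem IsPascalArray.succ_succ_eq_zero {c : ℕ → ℕ → ℝ} (hc : IsPascalArray c) (h : c 1 1 = 0)
    {n j : ℕ} (hj : j ≤ n) : c (n + 1) (j + 1) = 0 := by
  have h1 := pascal_sum_choose hc.pascal n (le_refl 1)
  rw [h] at h1
  have h2 := (sum_eq_zero_iff_of_nonneg fun i hi => mul_nonneg (Nat.cast_nonneg _)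
    (hc.nonneg (by have := mem_range.1 hi; omega))).1 h1.symm j (mem_range.2 (by omega))
  have h3 : (n.choose j : ℝ) ≠ 0 := by exact_mod_cast (Nat.choose_pos hj).ne'
  rw [add_comm n 1, add_comm j 1]
  exact (mul_eq_zero.1 h2).resolve_left h3

theorem IsPascalArray.succ_eq_zero {c : ℕ → ℕ → ℝ} (hc : IsPascalArray c) (h : c 1 0 = 0)
    {n j : ℕ} (hj : j ≤ n) : c (n + 1) j = 0 := by
  have h1 := pascal_sum_choose hc.pascal n (Nat.zero_le 1)
  rw [h] at h1
  have h2 := (sum_eq_zero_iff_of_nonneg fun i hi => mul_nonneg (Nat.cast_nonneg _)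
    (hc.nonneg (by have := mem_range.1 hi; omega))).1 h1.symm j (mem_range.2 (by omega))
  have h3 : (n.choose j : ℝ) ≠ 0 := by exact_mod_cast (Nat.choose_pos hj).ne'
  rw [add_comm n 1]
  simpa using (mul_eq_zero.1 h2).resolve_left h3

/-- For an extreme law, the event that a given element is singular is independent of the others. -/
theorem singularArray_succ_of_extreme {P : Measure VirtualPerm}
    (hP : P ∈ Set.extremePoints ℝ≥0 issLaws) {n j : ℕ} (hj : j ≤ n) :
    singularArray P (n + 1) (j + 1) = singularArray P 1 1 * singularArray P n j := by
  obtain ⟨⟨hprob, hiss⟩, hext⟩ := hP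
  have hc := hiss.isPascalArray
  have hν := hiss.hasArray
  have hrep := hiss.represents
  have hsum := hc.one_one_add
  generalize singularArray P = c at *
  -- The cases in which one of the two conditionings is on a null event are treated apart.
  by_cases h1 : c 1 1 = 0
  · rw [h1, zero_mul, hc.succ_succ_eq_zero h1 hj]
  by_cases h0 : c 1 0 = 0
  · rw [h0, add_zero] at hsum
    rw [hsum, one_mul, hc.pascal hj, hc.succ_eq_zero h0 hj, zero_add]
  have : IsProbabilityMeasure ((cond (P.map singularSet) (setCylinder 1 univ)).map shiftSet) :=
    isProbabilityMeasure_cond_shiftSet hν (by simpa using h1)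
  have : IsProbabilityMeasure ((cond (P.map singularSet) (setCylinder 1 ∅)).map shiftSet) :=
    isProbabilityMeasure_cond_shiftSet hν (by simpa using h0)
  have hr1 := hν.cond_univ.represents_mergeLaw
  have hr0 := hν.cond_empty.represents_mergeLaw
  have hp1 := hν.cond_univ.isPascalArray
  set P₁ := mergeLaw ((cond (P.map singularSet) (setCylinder 1 univ)).map shiftSet)
  set P₀ := mergeLaw ((cond (P.map singularSet) (setCylinder 1 ∅)).map shiftSet)
  let a : ℝ≥0 := ⟨c 1 1, hc.nonneg le_rfl⟩
  let b : ℝ≥0 := ⟨c 1 0, hc.nonneg zero_le_one⟩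
  have hab : a + b = 1 := NNReal.eq hsum
  have := isProbabilityMeasure_convexComb P₁ P₀ hab
  have hcomb : a • P₁ + b • P₀ = P :=
    (hr1.convexComb hr0 a b).eq_of_array hrep fun n j hj => by
      -- With these weights, the mixture of the conditioned arrays is the Pascal recursion itself.
      change c 1 1 * ((c 1 1)⁻¹ * c (n + 1) (j + 1)) + c 1 0 * ((c 1 0)⁻¹ * c (n + 1) j) = c n j
      rw [mul_inv_cancel_left₀ h1, mul_inv_cancel_left₀ h0, hc.pascal hj, add_comm]
  have hP₁ : P₁ = P := hext ⟨inferInstance, hr1.isISS⟩ ⟨inferInstance, hr0.isISS⟩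
    ⟨a, b, pos_iff_ne_zero.2 fun h => h1 (congrArg NNReal.toReal h),
      pos_iff_ne_zero.2 fun h => h0 (congrArg NNReal.toReal h), hab, hcomb⟩
  -- Now `P` is represented by `c` and by the conditioned array, so the two agree.
  rw [hP₁] at hr1
  rw [← hr1.array_eq hrep hp1 hc hj, mul_inv_cancel_left₀ h1]

theorem exists_piLaw_eq_of_extreme {P : Measure VirtualPerm}
    (hP : P ∈ Set.extremePoints ℝ≥0 issLaws) : ∃ α, piLaw α = P := by
  obtain ⟨hprob, hiss⟩ := hP.1
  have hc := hiss.isPascalArray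
  let α : unitInterval := ⟨singularArray P 1 1, hc.nonneg le_rfl, hc.le_one le_rfl⟩
  exact ⟨α, (represents_piLaw α).eq_of_array hiss.represents fun n j hj =>
    (hc.eq_bernoulliArray (α := α) (fun n j hj => singularArray_succ_of_extreme hP hj) hj).symm⟩

theorem theorem2 :
    -- the extreme ISS virtual permutations are exactly the `Π^α`
    Set.extremePoints ℝ≥0 issLaws = Set.range piLaw ∧
    -- in `Π^α` the marked elements are almost surely exactly the singular elements
    (∀ α : unitInterval, ∀ᵐ x ∂(enrichedLaw α), {i | (merge x.1 x.2).IsSingular i} = x.1) ∧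
    -- the law `Π^α` is characterized by the probability function
    (∀ (α : unitInterval) (P : Measure VirtualPerm), IsProbabilityMeasure P →
      (P = piLaw α ↔ ∀ (n : ℕ) (σ : Equiv.Perm (Fin n)),
        P.real {π | π.perm n = σ} = probFun α n (numFixed σ))) := by
  refine ⟨Set.Subset.antisymm (fun P hP => exists_piLaw_eq_of_extreme hP) ?_, ae_singularSet_eq,
    fun α P _ => eq_piLaw_iff α P⟩
  rintro _ ⟨α, rfl⟩
  exact piLaw_mem_extremePoints α
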